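/- **Conventions.** Let $\Sigma$ be a finite alphabet with two distinct symbols $0,1\in\Sigma$. A multi-function $f:A\rightrightarrows B$ assigns to every $a\in A$ a set $f(a)\subseteq B$; $\mathrm{dom}(f)=\{a: f(a)\neq\emptyset\}$; it is a partial function if every $f(a)$ has at most one element. A *generalized multi-representation* of $B$ is a multi-function $\delta:U\rightrightarrows B$ with $\bigcup_{u}\delta(u)=B$; it is a *multi-representation* if $U=\Sigma^\omega$. The relational composition is $(\delta\odot\gamma)(x)=\{z:\exists y\,(y\in\gamma(x)\wedge z\in\delta(y))\}$. For $f:X_1\times\dots\times X_n\rightrightarrows X_0$, $g:Y_1\times\dots\times Y_n\rightrightarrows Y_0$ and $\gamma_i:X_i\rightrightarrows Y_i$, $f$ *realizes* $g$ via $(\gamma_1,\dots,\gamma_n,\gamma_0)$ if for all $x,y$ with $y_j\in\gamma_j(x_j)$ $(1\le j\le n)$ and $y\in\mathrm{dom}(g)$ we have $f(x)\neq\emptyset$ and $g(y)\cap\gamma_0(x_0)\neq\emptyset$ for all $x_0\in f(x)$. A partial function from $(\Sigma^\omega)^n$ to $\Sigma^\omega$ or to $\Sigma^*$ is *computable* if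 it has an extension computed by a Type-2 machine. If $\gamma_j:\Sigma^\omega\rightrightarrows Y_j$ are multi-representations, $g:Y_1\times\dots\times Y_n\rightrightarrows Y_0$ is $(\gamma_1,\dots,\gamma_n,\gamma_0)$-*computable* if some computable partial function $(\Sigma^\omega)^n\to\Sigma^\omega$ realizes $g$ via $(\gamma_1,\dots,\gamma_n,\gamma_0)$; likewise, with the identity $I_*$ on $\Sigma^*$ in place of $\gamma_0$ and computable partial functions $(\Sigma^\omega)^n\to\Sigma^*$, if $g$ has values in $\Sigma^*$. **Machines.** A generalized Turing machine $M$ has a finite set of labels with an initial label $l_0$ and a final label $l_f$, a finite work alphabet $\Gamma$ with a blank symbol, numbers $k\le L$, tapes $0,\dots,L$ (tape $0$ is the output tape, tapes $1,\dots,k$ are the input tapes) with sets $X_0,\dots,X_L$ disjoint from $\Gamma$, and for every label $l\ne l_f$ one of the statements: move the head of tape $i$ right or left and go to $l'$; write $a\in\Gamma$ on tape $i$ and go to $l'$; if tape $i$ scans $a\in\Gamma$ then go to $l'$, else to $l''$; $(i:=f(i_1,\dots,i_n),l')$ with a multi-function $f:X_{i_1}\times\dots\times X_{i_n}\rightrightarrows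 X_i$; (if $f(i_1,\dots,i_n)$ then $l'$, else $l''$) with a partial function $f:X_{i_1}\times\dots\times X_{i_n}\to\{0,1\}\subseteq\Sigma^*$ (value $0$ leads to $l'$, value $1$ to $l''$). Each cell (indexed by $\mathbb Z$) of tape $i$ holds an element of $X_i\cup\Gamma$; an assignment writes any element of $f(x_{i_1},\dots,x_{i_n})$, where $x_j$ is the content scanned on tape $j$; if $f(x_{i_1},\dots,x_{i_n})$ is undefined or empty there is no successor configuration. Initially the label is $l_0$, all heads are at position $0$, cell $0$ of input tape $i$ contains $x_i$, and all other cells are blank. A configuration is accepting if its label is $l_f$ and cell $0$ of tape $0$ contains an element of $X_0$, which is then the result. The multi-function $f_M:X_1\times\dots\times X_k\rightrightarrows X_0$ computed by $M$ is defined by: $x_0\in f_M(x)$ iff every maximal computation on input $x$ is finite and ends in an accepting configuration, and some accepting computation on input $x$ has the result $x_0$. **Theorem t5.** Let $P$ be a generalized Turing machine with tape sets $(Z_i)_{0\le i\le L}$. For $0\le i\le L$ let $\delta_i:Y_i\rightrightarrows Z_i$ be a generalized multi-representation and $\gamma_i:\Sigma^\omega\rightrightarrows Y_i$ a multi-representation.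 Suppose that 1. for every statement $(i:=f(i_1,\dots,i_n),l')$ of $P$, $f$ has a realization $g$ via $(\delta_{i_1},\dots,\delta_{i_n},\delta_i)$ that is $(\gamma_{i_1},\dots,\gamma_{i_n},\gamma_i)$-computable; 2. for every statement (if $f(i_1,\dots,i_n)$ then $l'$, else $l''$) of $P$, $f$ has a realization $g$ via $(\delta_{i_1},\dots,\delta_{i_n},I_*)$ that is $(\gamma_{i_1},\dots,\gamma_{i_n},I_*)$-computable. Then there is a generalized Turing machine $M$ with tape sets $(Y_i)_{0\le i\le L}$ obtained from $P$ by replacing every function or test $f$ by some $g$ as in 1. and 2., and for every such $M$: (a) $f_M$ is $(\gamma_1,\dots,\gamma_k,\gamma_0)$-computable; (b) $f_M$ realizes $f_P$ via $(\delta_1,\dots,\delta_k,\delta_0)$. Moreover, (c) $f_P$ is $(\delta_1\odot\gamma_1,\dots,\delta_k\odot\gamma_k,\delta_0\odot\gamma_0)$-computable. -/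

import Mathlib

universe u v w z

/-! ## Multi-functions, multi-representations, realization -/

/-- A multi-function `f : A ⇉ B`; `f a` is the set of acceptable values at `a`,
and the domain of `f` is the set of all `a` for which `f a` is nonempty. -/
abbrev MultiFun (A : Type u) (B : Type v) : Type (max u v) := A → Set B

/-- A multi-function is an (ordinary) partial function if it has at most one value everywhere. -/
def MultiFun.IsPartialFun {A : Type u} {B : Type v} (f : MultiFun A B) : Prop :=
  ∀ a, (f a).Subsingleton

/-- A multi-function `U ⇉ B` is a generalized multi-representation of `B` if its range is
all of `B`. It is a multi-representation if `U` is the set of infinite sequences over the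
alphabet. -/
def MultiFun.IsMultiRep {U : Type u} {B : Type v} (γ : MultiFun U B) : Prop :=
  ∀ b, ∃ a, b ∈ γ a

/-- The relational composition `δ ⊙ γ`. -/
def MultiFun.relComp {A : Type u} {B : Type v} {C : Type w}
    (δ : MultiFun B C) (γ : MultiFun A B) : MultiFun A C :=
  fun x => {z | ∃ y, y ∈ γ x ∧ z ∈ δ y}

/-- `Realizes γ γ₀ f g`: the multi-function `f : X₁ × ⋯ × Xₙ ⇉ X₀` realizes
`g : Y₁ × ⋯ × Yₙ ⇉ Y₀` via `(γ₁, …, γₙ, γ₀)`, where `γᵢ : Xᵢ ⇉ Yᵢ`. -/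
def Realizes {n : ℕ} {X : Fin n → Type u} {Y : Fin n → Type v} {X₀ : Type w} {Y₀ : Type z}
    (γ : ∀ j, MultiFun (X j) (Y j)) (γ₀ : MultiFun X₀ Y₀)
    (f : MultiFun (∀ j, X j) X₀) (g : MultiFun (∀ j, Y j) Y₀) : Prop :=
  ∀ (x : ∀ j, X j) (y : ∀ j, Y j), (∀ j, y j ∈ γ j (x j)) → (g y).Nonempty →
    (f x).Nonempty ∧ ∀ x₀ ∈ f x, (g y ∩ γ₀ x₀).Nonempty

/-! ## Type-2 machines and computable functions on infinite sequences -/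

/-- A finite alphabet with two distinguished distinct symbols `0` and `1`. Finite words over
`A` are elements of `List A`, infinite sequences over `A` are functions `ℕ → A`. -/
class Alphabet (A : Type) where
  /-- the alphabet is finite -/
  finite : Finite A
  /-- the symbol `0` -/
  zero : A
  /-- the symbol `1` -/
  one : A
  zero_ne_one : zero ≠ one

/-- The word `0` (of length one). -/
def wordZero (A : Type) [Alphabet A] : List A := [Alphabet.zero]

/-- The word `1` (of length one). -/
def wordOne (A : Type) [Alphabet A] : List A := [Alphabet.one]

/-- The action of a Type-2 machine in one step: the next state, which input heads advance by
one cell, what is written on each work tape and how its head moves afterwards (`none`: it does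
not move), and the symbol, if any, that is appended to the output. -/
structure Type2Action (A State Work : Type) (n m : ℕ) where
  next : State
  advance : Fin n → Bool
  work : Fin m → Work × Option Turing.Dir
  emit : Option A

/-- A Type-2 machine with `n` one-way read-only input tapes carrying infinite sequences over
`A`, finitely many two-way work tapes, and a one-way write-only output tape. The transition
function sees the state, the scanned input symbols, and the scanned work symbols; the machine
halts when the transition is `none`. The blank symbol of the work tapes is the default element
of the work alphabet. -/
structure Type2Machine (A : Type) (n : ℕ) where
  State : Type
  stateFinite : Finite State
  start : State
  Work : Type
  workFinite : Finite Work
  workBlank : Inhabited Work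
  m : ℕ
  trans : State → (Fin n → A) → (Fin m → Work) → Option (Type2Action A State Work n m)

namespace Type2Machine

attribute [instance] Type2Machine.workBlank

variable {A : Type} {n : ℕ}

/-- Configurations: state, positions of the input heads, work tapes (with their heads), and
the word written so far on the output tape. -/
structure Cfg (M : Type2Machine A n) where
  state : M.State
  pos : Fin n → ℕ
  work : Fin M.m → Turing.Tape M.Work
  out : List A

/-- The initial configuration. -/
def init (M : Type2Machine A n) : M.Cfg :=
  { state := M.start, pos := fun _ => 0, work := fun _ => default, out := [] }

/-- The result of performing an action. -/
def act (M : Type2Machine A n) (a : Type2Action A M.State M.Work n M.m) (c : M.Cfg) : M.Cfg where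
  state := a.next
  pos j := if a.advance j then c.pos j + 1 else c.pos j
  work r :=
    match (a.work r).2 with
    | none => (c.work r).write (a.work r).1
    | some d => ((c.work r).write (a.work r).1).move d
  out := c.out ++ a.emit.toList

/-- One step on input `p`; `none` means that the machine halts in configuration `c`. -/
def step (M : Type2Machine A n) (p : Fin n → ℕ → A) (c : M.Cfg) : Option M.Cfg :=
  (M.trans c.state (fun j => p j (c.pos j)) (fun r => (c.work r).head)).map fun a => M.act a c

/-- The configuration after `t` steps on input `p`, if the machine has not halted before. -/
def run (M : Type2Machine A n) (p : Fin n → ℕ → A) : ℕ → Option M.Cfg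
  | 0 => some M.init
  | t + 1 => (M.run p t).bind (M.step p)

/-- The function with values in the set of words computed by the machine: `w` is its value at
`p` iff the machine halts on input `p` with `w` on the output tape. -/
def wordFun (M : Type2Machine A n) : MultiFun (Fin n → ℕ → A) (List A) :=
  fun p => {w | ∃ t c, M.run p t = some c ∧ M.step p c = none ∧ c.out = w}

/-- The function with values in the set of infinite sequences computed by the machine: `q` is
its value at `p` iff the machine computes forever on input `p` and writes `q` on the output
tape. -/
def seqFun (M : Type2Machine A n) : MultiFun (Fin n → ℕ → A) (ℕ → A) :=
  fun p => {q |
    (∀ t, ∃ c, M.run p t = some c ∧ c.out = (List.range c.out.length).map q) ∧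
    (∀ N, ∃ t c, M.run p t = some c ∧ N ≤ c.out.length)}

end Type2Machine

/-- A partial function from tuples of infinite sequences to words is computable if it has an
extension that is computed by a Type-2 machine. -/
def IsComputableWordFun {A : Type} {n : ℕ} (f : MultiFun (Fin n → ℕ → A) (List A)) : Prop :=
  f.IsPartialFun ∧ ∃ M : Type2Machine A n, ∀ p, ∀ w ∈ f p, w ∈ M.wordFun p

/-- A partial function from tuples of infinite sequences to infinite sequences is computable
if it has an extension that is computed by a Type-2 machine. -/
def IsComputableSeqFun {A : Type} {n : ℕ} (f : MultiFun (Fin n → ℕ → A) (ℕ → A)) : Prop :=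
  f.IsPartialFun ∧ ∃ M : Type2Machine A n, ∀ p, ∀ q ∈ f p, q ∈ M.seqFun p

/-- The identity on words, as a (multi-)representation of the set of words by itself. -/
def idWord (A : Type) : MultiFun (List A) (List A) := fun w => {w}

/-- `g : Y₁ × ⋯ × Yₙ ⇉ Y₀` is `(γ₁, …, γₙ, γ₀)`-computable: it has a computable realization on
infinite sequences. -/
def RelComputable {A : Type} {n : ℕ} {Y : Fin n → Type u} {Y₀ : Type v}
    (γ : ∀ j, MultiFun (ℕ → A) (Y j)) (γ₀ : MultiFun (ℕ → A) Y₀)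
    (g : MultiFun (∀ j, Y j) Y₀) : Prop :=
  ∃ h : MultiFun (Fin n → ℕ → A) (ℕ → A), IsComputableSeqFun h ∧
    Realizes (X := fun _ => ℕ → A) γ γ₀ h g

/-- The word-valued `g` is `(γ₁, …, γₙ, id)`-computable, where `id` is the identity on words. -/
def RelComputableWord {A : Type} {n : ℕ} {Y : Fin n → Type u}
    (γ : ∀ j, MultiFun (ℕ → A) (Y j)) (g : MultiFun (∀ j, Y j) (List A)) : Prop :=
  ∃ h : MultiFun (Fin n → ℕ → A) (List A), IsComputableWordFun h ∧
    Realizes (X := fun _ => ℕ → A) γ (idWord A) h g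

/-! ## Generalized Turing machines -/

/-- The data of a generalized Turing machine apart from the tape sets and the statements:
a finite set of labels with an initial and a final label, a finite work alphabet `Γ` with a
blank symbol, and the numbers `k ≤ L`. The tapes are numbered `0, …, L`; tape `0` is the output
tape and the tapes `1, …, k` are the input tapes. -/
structure GTMFrame where
  Label : Type
  labelFinite : Finite Label
  start : Label
  final : Label
  Γ : Type
  symFinite : Finite Γ
  blank : Γ
  k : ℕ
  L : ℕ
  k_le : k ≤ L

/-- The tape carrying the input number `j` (counted from `0`), i.e. tape `j + 1`. -/
def GTMFrame.inTape (F : GTMFrame) (j : Fin F.k) : Fin (F.L + 1) :=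
  (Fin.castLE F.k_le j).succ

/-- The statements of a generalized Turing machine with tape sets `X₀, …, X_L`:
* `right i l'`, `left i l'`: move the head on tape `i`, go to `l'`;
* `write i a l'`: write the symbol `a ∈ Γ` on tape `i`, go to `l'`;
* `ifSym i a l' l''`: if `a ∈ Γ` is scanned on tape `i` go to `l'`, else to `l''`;
* `assign i t f l'`: the assignment `i := f(t₁, …, tₙ)` with a multi-function `f`, go to `l'`;
* `test t f l' l''`: if `f(t₁, …, tₙ)` then `l'` else `l''`, for a partial function `f` whose
  values are among the words `0` (true) and `1` (false). -/
inductive Stmt (A : Type) [Alphabet A] (F : GTMFrame) (X : Fin (F.L + 1) → Type u) : Type u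
  | right (i : Fin (F.L + 1)) (l' : F.Label)
  | left (i : Fin (F.L + 1)) (l' : F.Label)
  | write (i : Fin (F.L + 1)) (a : F.Γ) (l' : F.Label)
  | ifSym (i : Fin (F.L + 1)) (a : F.Γ) (l' l'' : F.Label)
  | assign (i : Fin (F.L + 1)) {n : ℕ} (t : Fin n → Fin (F.L + 1))
      (f : MultiFun (∀ j, X (t j)) (X i)) (l' : F.Label)
  | test {n : ℕ} (t : Fin n → Fin (F.L + 1)) (f : MultiFun (∀ j, X (t j)) (List A))
      (partialFun : f.IsPartialFun) (range : ∀ x, f x ⊆ {wordZero A, wordOne A})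
      (l' l'' : F.Label)

/-- A generalized Turing machine: every label except the final one carries a statement. -/
structure GTM (A : Type) [Alphabet A] (F : GTMFrame) (X : Fin (F.L + 1) → Type u) where
  stm : {l : F.Label // l ≠ F.final} → Stmt A F X

namespace GTM

/-- Configurations: label, inscriptions of the tapes, head positions. A cell of tape `i`
contains an element of the disjoint union of `X i` and the work alphabet. -/
@[ext] structure Conf (F : GTMFrame) (X : Fin (F.L + 1) → Type u) where
  label : F.Label
  tape : ∀ i : Fin (F.L + 1), ℤ → X i ⊕ F.Γ
  head : Fin (F.L + 1) → ℤ

variable {A : Type} [Alphabet A] {F : GTMFrame} {X : Fin (F.L + 1) → Type u}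

/-- The content of the cell scanned by the head of tape `i`. -/
def Conf.scan (c : Conf F X) (i : Fin (F.L + 1)) : X i ⊕ F.Γ := c.tape i (c.head i)

/-- Change the label. -/
def Conf.goto (c : Conf F X) (l : F.Label) : Conf F X := { c with label := l }

/-- Move the head on tape `i` to position `m`. -/
def Conf.setHead (c : Conf F X) (i : Fin (F.L + 1)) (m : ℤ) : Conf F X :=
  { c with head := Function.update c.head i m }

/-- Write `x` under the head of tape `i`. -/
def Conf.setCell (c : Conf F X) (i : Fin (F.L + 1)) (x : X i ⊕ F.Γ) : Conf F X :=
  { c with tape := Function.update c.tape i (Function.update (c.tape i) (c.head i) x) }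

/-- `Exec s c c'`: executing the statement `s` can lead from `c` to `c'`. -/
def Exec : Stmt A F X → Conf F X → Conf F X → Prop
  | .right i l', c, c' => c' = (c.setHead i (c.head i + 1)).goto l'
  | .left i l', c, c' => c' = (c.setHead i (c.head i - 1)).goto l'
  | .write i a l', c, c' => c' = (c.setCell i (Sum.inr a)).goto l'
  | .ifSym i a l' l'', c, c' =>
      (c.scan i = Sum.inr a ∧ c' = c.goto l') ∨ (c.scan i ≠ Sum.inr a ∧ c' = c.goto l'')
  | .assign i t f l', c, c' =>
      ∃ x : ∀ j, X (t j), (∀ j, c.scan (t j) = Sum.inl (x j)) ∧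
        ∃ y ∈ f x, c' = (c.setCell i (Sum.inl y)).goto l'
  | .test t f _ _ l' l'', c, c' =>
      ∃ x : ∀ j, X (t j), (∀ j, c.scan (t j) = Sum.inl (x j)) ∧
        ((wordZero A ∈ f x ∧ c' = c.goto l') ∨ (wordOne A ∈ f x ∧ c' = c.goto l''))

/-- The successor relation on configurations. -/
def Step (M : GTM A F X) (c c' : Conf F X) : Prop :=
  ∃ h : c.label ≠ F.final, Exec (M.stm ⟨c.label, h⟩) c c'

/-- The initial configuration for the input `x`: all heads are at position `0`, the cell `0`
of each input tape contains the input, and all other cells are blank. -/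
def initConf (x : ∀ j : Fin F.k, X (F.inTape j)) : Conf F X where
  label := F.start
  tape i := Fin.cases (motive := fun i => ℤ → X i ⊕ F.Γ) (fun _ => Sum.inr F.blank)
    (fun i' m => if h : i'.1 < F.k ∧ m = 0 then Sum.inl (x ⟨i'.1, h.1⟩) else Sum.inr F.blank) i
  head _ := 0

/-- `c` is accepting with result `x₀`: the label is final and the cell `0` of tape `0`
contains `x₀ ∈ X₀`. -/
def AcceptsWith (c : Conf F X) (x₀ : X 0) : Prop :=
  c.label = F.final ∧ c.tape 0 0 = Sum.inl x₀

/-- Accepting configurations. -/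
def Accepting (c : Conf F X) : Prop := ∃ x₀, AcceptsWith c x₀

/-- Every maximal computation from `c` is accepting: there is no infinite computation from
`c`, and every finite computation from `c` whose last configuration has no successor ends in
an accepting configuration. -/
def AllMaximalAccepting (M : GTM A F X) (c : Conf F X) : Prop :=
  (¬ ∃ s : ℕ → Conf F X, s 0 = c ∧ ∀ n, M.Step (s n) (s (n + 1))) ∧
  ∀ c', Relation.ReflTransGen M.Step c c' → (∀ c'', ¬ M.Step c' c'') → Accepting c'

/-- The multi-function `f_M : X₁ × ⋯ × X_k ⇉ X₀` computed by `M`. -/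
def computes (M : GTM A F X) : MultiFun (∀ j : Fin F.k, X (F.inTape j)) (X 0) :=
  fun x => {x₀ | M.AllMaximalAccepting (initConf x) ∧
    ∃ c, Relation.ReflTransGen M.Step (initConf x) c ∧ AcceptsWith c x₀}

end GTM

/-- `StmtReplaces γ δ s s'`: the statement `s` (on the sets `Y i`) is equal to the statement `s'`
(on the sets `Z i`), except that the function `f` in `s'`, if any, is replaced by a function
`g` that realizes `f` via the `δ i` and is computable with respect to the `γ i`. -/
inductive StmtReplaces {A : Type} [Alphabet A] {F : GTMFrame} {Y : Fin (F.L + 1) → Type u}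
    {Z : Fin (F.L + 1) → Type v} (γ : ∀ i, MultiFun (ℕ → A) (Y i))
    (δ : ∀ i, MultiFun (Y i) (Z i)) : Stmt A F Y → Stmt A F Z → Prop
  | right (i : Fin (F.L + 1)) (l' : F.Label) : StmtReplaces γ δ (.right i l') (.right i l')
  | left (i : Fin (F.L + 1)) (l' : F.Label) : StmtReplaces γ δ (.left i l') (.left i l')
  | write (i : Fin (F.L + 1)) (a : F.Γ) (l' : F.Label) :
      StmtReplaces γ δ (.write i a l') (.write i a l')
  | ifSym (i : Fin (F.L + 1)) (a : F.Γ) (l' l'' : F.Label) :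
      StmtReplaces γ δ (.ifSym i a l' l'') (.ifSym i a l' l'')
  | assign (i : Fin (F.L + 1)) {n : ℕ} (t : Fin n → Fin (F.L + 1))
      (g : MultiFun (∀ j, Y (t j)) (Y i)) (f : MultiFun (∀ j, Z (t j)) (Z i)) (l' : F.Label)
      (realizes : Realizes (fun j => δ (t j)) (δ i) g f)
      (computable : RelComputable (fun j => γ (t j)) (γ i) g) :
      StmtReplaces γ δ (.assign i t g l') (.assign i t f l')
  | test {n : ℕ} (t : Fin n → Fin (F.L + 1))
      (g : MultiFun (∀ j, Y (t j)) (List A)) (hg : g.IsPartialFun)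
      (hg' : ∀ x, g x ⊆ {wordZero A, wordOne A})
      (f : MultiFun (∀ j, Z (t j)) (List A)) (hf : f.IsPartialFun)
      (hf' : ∀ x, f x ⊆ {wordZero A, wordOne A}) (l' l'' : F.Label)
      (realizes : Realizes (fun j => δ (t j)) (idWord A) g f)
      (computable : RelComputableWord (fun j => γ (t j)) g) :
      StmtReplaces γ δ (.test t g hg hg' l' l'') (.test t f hf hf' l' l'')

/-- `M` is obtained from `P` by replacing every function `f` by a function `g` that realizes
`f` via the `δ i` and is computable with respect to the `γ i`. -/
def GTM.ObtainedFrom {A : Type} [Alphabet A] {F : GTMFrame} {Y : Fin (F.L + 1) → Type u}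
    {Z : Fin (F.L + 1) → Type v} (γ : ∀ i, MultiFun (ℕ → A) (Y i))
    (δ : ∀ i, MultiFun (Y i) (Z i)) (M : GTM A F Y) (P : GTM A F Z) : Prop :=
  ∀ l, StmtReplaces γ δ (M.stm l) (P.stm l)

/-!
A machine `M` simulates `P` if each statement of `P` is replaced by a realization: related
configurations have related successors. If all maximal computations of `P` accept, then its
computation tree is well-founded, and induction on it transfers acceptance and results, so `f_M`
realizes `f_P`. In the same way the machine `M` on the sets `Y i` is simulated by a machine `N` on
infinite sequences whose functions and tests are computable. It remains to show that `f_N` is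
computable, and the rest follows by composing realizations.

An accepting computation of `N` has finitely many steps, and each step is continuous: it is
approximated by a primitive recursive function that maps finite prefixes of the sequences on the
tapes, and a number of steps granted to the Type-2 machines involved, to such prefixes. Iterating
these functions gives a primitive recursive function that maps prefixes of the input to prefixes of
the output and attains every length. A Type-2 machine evaluates it on longer and longer prefixes,
writing a letter as soon as it is known.
-/

/-! ## Words as approximations of infinite sequences -/

/-- The word `w` is a prefix of the infinite sequence `q`. -/
def SeqPrefix {A : Type*} (w : List A) (q : ℕ → A) : Prop :=
  ∀ i a, w[i]? = some a → a = q i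

namespace SeqPrefix

variable {A : Type*} {w w' : List A} {q : ℕ → A}

theorem iff_eq_map_range : SeqPrefix w q ↔ w = (List.range w.length).map q := by
  constructor
  · intro h
    refine List.ext_getElem (by simp) fun i h₁ _ => ?_
    simpa using h i _ (List.getElem?_eq_getElem h₁)
  · intro h i a hi
    rw [h, List.getElem?_map, Option.map_eq_some_iff] at hi
    obtain ⟨b, hb, rfl⟩ := hi
    obtain ⟨_, rfl⟩ := List.getElem?_eq_some_iff.1 hb
    simp

theorem nil (q : ℕ → A) : SeqPrefix [] q := by simp [SeqPrefix]

theorem of_prefix (h : SeqPrefix w' q) (hw : w <+: w') : SeqPrefix w q := by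
  obtain ⟨t, rfl⟩ := hw
  intro i a hi
  refine h i a ?_
  rwa [List.getElem?_append_left (List.getElem?_eq_some_iff.1 hi).1]

theorem concat (h : SeqPrefix w q) {a : A} (ha : a = q w.length) : SeqPrefix (w ++ [a]) q := by
  intro i b hb
  rcases lt_trichotomy i w.length with hi | rfl | hi
  · exact h i b (by rwa [List.getElem?_append_left hi] at hb)
  · simp_all
  · simp [List.getElem?_eq_none (show (w ++ [a]).length ≤ i by simpa using hi)] at hb

theorem getElem?_eq (h : SeqPrefix w q) {i : ℕ} (hi : i < w.length) : w[i]? = some (q i) := by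
  rw [List.getElem?_eq_getElem hi, h i _ (List.getElem?_eq_getElem hi)]

end SeqPrefix

/-- The word consisting of the first `N` columns of a tuple of infinite sequences. -/
def columns {A : Type*} {n : ℕ} (p : Fin n → ℕ → A) (N : ℕ) : List (Fin n → A) :=
  (List.range N).map fun i j => p j i

theorem columns_succ {A : Type*} {n : ℕ} (p : Fin n → ℕ → A) (N : ℕ) :
    columns p (N + 1) = columns p N ++ [fun j => p j N] := by
  simp [columns, List.range_succ]

/-! ## Runs of Type-2 machines -/

namespace Type2Machine

variable {A : Type} {n : ℕ} {M : Type2Machine A n} {p : Fin n → ℕ → A}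

/-- The successor relation on configurations for the input `p`. -/
def Next (M : Type2Machine A n) (p : Fin n → ℕ → A) (c c' : M.Cfg) : Prop := M.step p c = some c'

theorem exists_run_of_transGen {c c' : M.Cfg} (h : Relation.TransGen (M.Next p) c c') {t : ℕ}
    (ht : M.run p t = some c) : ∃ t', t < t' ∧ M.run p t' = some c' := by
  induction h with
  | single h => exact ⟨t + 1, by omega, by simpa [run, ht, Next] using h⟩
  | tail _ h ih =>
    obtain ⟨t', h₁, h₂⟩ := ih
    exact ⟨t' + 1, by omega, by simpa [run, h₂, Next] using h⟩

theorem out_prefix_of_step {c c' : M.Cfg} (h : M.step p c = some c') : c.out <+: c'.out := by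
  simp only [step, Option.map_eq_some_iff] at h
  obtain ⟨a, _, rfl⟩ := h
  exact List.prefix_append _ _

theorem exists_run_of_le {t t' : ℕ} (htt : t ≤ t') {c' : M.Cfg} (h : M.run p t' = some c') :
    ∃ c, M.run p t = some c ∧ c.out <+: c'.out := by
  induction t', htt using Nat.le_induction generalizing c' with
  | base => exact ⟨c', h, List.prefix_rfl⟩
  | succ s _ ih =>
    obtain ⟨d, hd, hs⟩ := Option.bind_eq_some_iff.1 h
    obtain ⟨c, hc, hp⟩ := ih hd
    exact ⟨c, hc, hp.trans (out_prefix_of_step hs)⟩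

theorem mem_seqFun_of_frequently {q : ℕ → A}
    (h₁ : ∀ N, ∃ t c, N ≤ t ∧ M.run p t = some c ∧ SeqPrefix c.out q)
    (h₂ : ∀ N, ∃ t c, M.run p t = some c ∧ N ≤ c.out.length) : q ∈ M.seqFun p := by
  refine ⟨fun t => ?_, h₂⟩
  obtain ⟨t', c', htt, hr, hp⟩ := h₁ t
  obtain ⟨c, hc, hcp⟩ := exists_run_of_le htt hr
  exact ⟨c, hc, SeqPrefix.iff_eq_map_range.1 (hp.of_prefix hcp)⟩

theorem run_eq_none_of_halted {t t' : ℕ} {c : M.Cfg} (h : M.run p t = some c)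
    (hs : M.step p c = none) (ht : t < t') : M.run p t' = none := by
  induction t', ht using Nat.le_induction with
  | base => simp [run, h, hs]
  | succ s _ ih => simp [run, ih]

theorem wordFun_isPartialFun (M : Type2Machine A n) : M.wordFun.IsPartialFun := by
  rintro p _ ⟨t, c, hc, hs, rfl⟩ _ ⟨t', c', hc', hs', rfl⟩
  rcases lt_trichotomy t t' with ht | rfl | ht
  · simp [run_eq_none_of_halted hc hs ht] at hc'
  · rw [Option.some.inj (hc.symm.trans hc')]
  · simp [run_eq_none_of_halted hc' hs' ht] at hc

end Type2Machine

/-! ## Iterating codes for partial recursive functions on a Type-2 machine -/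

/-- The program of a machine that works in rounds: in a round whose number has the residue class
`i` modulo `m` it reads a column `a` of the input and replaces the contents `v` of its memory by
`(code a i).eval v`. At the beginning of the following round it writes `letter i` if the first
number in the memory is odd. -/
structure CodeTransducer (A : Type) (n m : ℕ) where
  code : (Fin n → A) → ZMod m → Turing.ToPartrec.Code
  letter : ZMod m → A

namespace CodeTransducer

open Turing Turing.PartrecToTM2

/-- Statements of the stack machine of Mathlib that evaluates codes. -/
abbrev StackStmt : Type := TM2.Stmt (fun _ : K' => Γ') Λ' (Option Γ')

/-- Configurations of the stack machine of Mathlib that evaluates codes. -/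
abbrev StackCfg : Type := TM2.Cfg (fun _ : K' => Γ') Λ' (Option Γ')

/-- The numbering of the stacks by the work tapes that carry them. -/
def tapeEquiv : K' ≃ Fin 4 where
  toFun
    | .main => 0
    | .rev => 1
    | .aux => 2
    | .stack => 3
  invFun := ![.main, .rev, .aux, .stack]
  left_inv k := by cases k <;> rfl
  right_inv r := by fin_cases r <;> rfl

/-- The tape carrying a stack, with the head on the top of the stack. -/
def stackTape (l : List Γ') : Tape (Option Γ') := Tape.mk' ∅ (ListBlank.mk (l.map some))

@[simp] theorem stackTape_head (l : List Γ') : (stackTape l).head = l.head? := by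
  cases l <;> rfl

/-- The work tapes carrying a family of stacks. -/
def stackTapes (stk : K' → List Γ') (r : Fin 4) : Tape (Option Γ') :=
  stackTape (stk (tapeEquiv.symm r))

theorem stackTapes_update (stk : K' → List Γ') (k : K') (l : List Γ') :
    stackTapes (Function.update stk k l) =
      Function.update (stackTapes stk) (tapeEquiv k) (stackTape l) := by
  funext r
  obtain ⟨k', rfl⟩ := tapeEquiv.surjective r
  by_cases h : k' = k
  · subst h
    simp [stackTapes]
  · simp [stackTapes, h]

/-- Write a symbol and possibly move the head. -/
def writeMove (x : Option Γ' × Option Dir) (W : Tape (Option Γ')) : Tape (Option Γ') :=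
  match x.2 with
  | none => W.write x.1
  | some d => (W.write x.1).move d

theorem writeMove_head (W : Tape (Option Γ')) : writeMove (W.head, none) W = W := Tape.write_self W

theorem writeMove_push (l : List Γ') (b : Γ') :
    writeMove (some b, none) (writeMove (l.head?, some .left) (stackTape l)) =
      stackTape (b :: l) := by
  have h : writeMove (l.head?, some .left) (stackTape l) = (stackTape l).move .left := by
    rw [writeMove, ← stackTape_head, Tape.write_self]
  rw [h, stackTape, Tape.move_left_mk', writeMove, Tape.write_mk']
  rfl

theorem writeMove_pop (l : List Γ') :
    writeMove (none, some .right) (stackTape l) = stackTape l.tail := by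
  have h : stackTape l = Tape.mk' ∅ ((ListBlank.mk (l.tail.map some)).cons l.head?) := by
    cases l with
    | nil => exact congrArg (Tape.mk' ∅) (ListBlank.cons_head_tail (ListBlank.mk [])).symm
    | cons a l => rfl
  change (((stackTape l).write none).move .right) = _
  rw [h, Tape.write_mk', Tape.move_right_mk', ListBlank.head_cons, ListBlank.tail_cons]
  exact congrArg (Tape.mk' · _) (ListBlank.cons_head_tail ∅)

variable {A : Type} {n m : ℕ}

/-- The statements of the stack machine that occur in the evaluation of the codes of `T`. -/
def support (T : CodeTransducer A n m) : Set StackStmt :=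
  {x | ∃ a i, ∃ l ∈ codeSupp (T.code a i) Cont'.halt, x ∈ TM2.stmts₁ (tr l)}

theorem finite_support [Finite A] [NeZero m] (T : CodeTransducer A n m) : T.support.Finite := by
  have h : T.support = ⋃ (a) (i), ⋃ l ∈ codeSupp (T.code a i) Cont'.halt,
      (TM2.stmts₁ (tr l) : Set StackStmt) := by
    ext x
    simp [support]
  rw [h]
  exact Set.finite_iUnion fun a => Set.finite_iUnion fun i =>
    (Finset.finite_toSet _).biUnion fun l _ => Finset.finite_toSet _

theorem start_mem_support (T : CodeTransducer A n m) (a : Fin n → A) (i : ZMod m) :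
    tr (trNormal (T.code a i) Cont'.halt) ∈ T.support :=
  ⟨a, i, _, codeSupp_self _ _ (trStmts₁_self _), TM2.stmts₁_self⟩

theorem mem_support_of_mem_stmts₁ {T : CodeTransducer A n m} {x y : StackStmt} (hx : x ∈ T.support)
    (hy : y ∈ TM2.stmts₁ x := by simp [TM2.stmts₁, TM2.stmts₁_self]) : y ∈ T.support := by
  obtain ⟨a, i, l, hl, hxl⟩ := hx
  exact ⟨a, i, l, hl, TM2.stmts₁_trans hxl hy⟩

theorem mem_support_of_goto {T : CodeTransducer A n m} {f : Option Γ' → Λ'}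
    (hf : TM2.Stmt.goto f ∈ T.support) (v : Option Γ') : tr (f v) ∈ T.support := by
  obtain ⟨a, i, l, hl, hfl⟩ := hf
  have h := TM2.stmts₁_supportsStmt_mono hfl
    (codeSupp_supports (Finset.Subset.refl (codeSupp (T.code a i) Cont'.halt)) l hl)
  exact ⟨a, i, f v, h v, TM2.stmts₁_self⟩

theorem mem_support_of_stepAux {T : CodeTransducer A n m} {x : StackStmt} (hx : x ∈ T.support)
    {v : Option Γ'} {stk : K' → List Γ'} {l : Λ'} (hl : (TM2.stepAux x v stk).l = some l) :
    tr l ∈ T.support := by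
  induction x generalizing v stk with
  | push k f q ih => exact ih (mem_support_of_mem_stmts₁ hx) hl
  | peek k f q ih => exact ih (mem_support_of_mem_stmts₁ hx) hl
  | pop k f q ih => exact ih (mem_support_of_mem_stmts₁ hx) hl
  | load f q ih => exact ih (mem_support_of_mem_stmts₁ hx) hl
  | branch f q₁ q₂ ih₁ ih₂ =>
    rw [TM2.stepAux] at hl
    cases hf : f v <;> rw [hf] at hl
    · exact ih₂ (mem_support_of_mem_stmts₁ hx) hl
    · exact ih₁ (mem_support_of_mem_stmts₁ hx) hl
  | goto f =>
    cases hl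
    exact mem_support_of_goto hx v
  | halt => cases hl

/-- States of the machine: the residue class of the round, and either `none` (between two rounds),
or a symbol that has to be pushed first, if any, the local variable of the stack machine, and the
statement to be executed. -/
abbrev State (T : CodeTransducer A n m) : Type :=
  ZMod m × Option (Option (K' × Γ') × Option Γ' × Option T.support)

open scoped Classical in
/-- A statement as a component of a state. -/
noncomputable def wrap (T : CodeTransducer A n m) (x : StackStmt) : Option T.support :=
  if h : x ∈ T.support then some ⟨x, h⟩ else none

/-- The action that enters the state `s` and, on work tape `r` only, performs `x`; here `hd` are
the scanned symbols. -/
def onTape (T : CodeTransducer A n m) (hd : Fin 4 → Option Γ') (s : T.State) (r : Fin 4)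
    (x : Option Γ' × Option Dir) : Type2Action A T.State (Option Γ') n 4 where
  next := s
  advance _ := false
  work r' := if r' = r then x else (hd r', none)
  emit := none

/-- The action that only enters the state `s`. -/
def idle (T : CodeTransducer A n m) (hd : Fin 4 → Option Γ') (s : T.State) :
    Type2Action A T.State (Option Γ') n 4 :=
  T.onTape hd s 0 (hd 0, none)

/-- The first action in the execution of a statement of the stack machine. A push is performed in
two steps, since the head has to move before the new symbol is written. -/
noncomputable def exec (T : CodeTransducer A n m) (i : ZMod m) (v : Option Γ')
    (hd : Fin 4 → Option Γ') : StackStmt → Type2Action A T.State (Option Γ') n 4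
  | .push k f q => T.onTape hd (i, some (some (k, f v), v, T.wrap q)) (tapeEquiv k)
      (hd (tapeEquiv k), some .left)
  | .peek k f q => T.idle hd (i, some (none, f v (hd (tapeEquiv k)), T.wrap q))
  | .pop k f q => T.onTape hd (i, some (none, f v (hd (tapeEquiv k)), T.wrap q)) (tapeEquiv k)
      (none, some .right)
  | .load f q => T.idle hd (i, some (none, f v, T.wrap q))
  | .branch f q₁ q₂ => T.idle hd (i, some (none, v, T.wrap (cond (f v) q₁ q₂)))
  | .goto f => T.idle hd (i, some (none, v, T.wrap (tr (f v))))
  | .halt => T.idle hd (i, none)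

/-- The transition function. -/
noncomputable def trans (T : CodeTransducer A n m) (s : T.State) (a : Fin n → A)
    (hd : Fin 4 → Option Γ') : Option (Type2Action A T.State (Option Γ') n 4) :=
  match s with
  | (i, none) => some
      { next := (i + 1, some (none, none, T.wrap (tr (trNormal (T.code a (i + 1)) Cont'.halt))))
        advance := fun _ => true
        work := fun r => (hd r, none)
        emit := if hd 0 = some Γ'.bit1 then some (T.letter i) else none }
  | (i, some (some (k, b), v, x)) => some
      (T.onTape hd (i, some (none, v, x)) (tapeEquiv k) (some b, none))
  | (i, some (none, v, some x)) => some (T.exec i v hd x.1)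
  | (_, some (none, _, none)) => none

theorem trans_of_mem_support {T : CodeTransducer A n m} {x : StackStmt} (hx : x ∈ T.support)
    (i : ZMod m) (v : Option Γ') (a : Fin n → A) (hd : Fin 4 → Option Γ') :
    T.trans (i, some (none, v, T.wrap x)) a hd = some (T.exec i v hd x) := by
  rw [wrap, dif_pos hx]
  rfl

/-- The first number in the memory at the beginning of round `N`, if round `i` replaces it by its
image under `f a i` when it reads the column `a`. -/
def memory (f : (Fin n → A) → ZMod m → ℕ → ℕ) (p : Fin n → ℕ → A) : ℕ → ℕ
  | 0 => 0
  | N + 1 => f (fun j => p j N) (N + 1) (memory f p N)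

/-- The word written before round `N`. -/
def written (f : (Fin n → A) → ZMod m → ℕ → ℕ) (letter : ZMod m → A) (p : Fin n → ℕ → A) :
    ℕ → List A
  | 0 => []
  | N + 1 => written f letter p N ++ if memory f p N % 2 = 1 then [letter N] else []

variable [Finite A] [NeZero m] (T : CodeTransducer A n m)

/-- The Type-2 machine that runs the program. -/
noncomputable def machine : Type2Machine A n where
  State := T.State
  stateFinite := by
    have := Finite.of_equiv _ tapeEquiv.symm
    have := T.finite_support.to_subtype
    infer_instance
  start := (0, none)
  Work := Option Γ'
  workFinite := inferInstance
  workBlank := ⟨none⟩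
  m := 4
  trans := T.trans

/-- A configuration of the machine. -/
def tapeCfg (s : T.State) (pos : Fin n → ℕ) (W : Fin 4 → Tape (Option Γ')) (out : List A) :
    T.machine.Cfg where
  state := s
  pos := pos
  work := W
  out := out

/-- A configuration of the machine, given by the stacks. -/
def cfg (s : T.State) (pos : Fin n → ℕ) (stk : K' → List Γ') (out : List A) : T.machine.Cfg :=
  T.tapeCfg s pos (stackTapes stk) out

/-- The state corresponding to a configuration of the stack machine. -/
noncomputable def stateOf (i : ZMod m) (c : StackCfg) : T.State :=
  (i, c.l.map fun l => (none, c.var, T.wrap (tr l)))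

variable {T} {p : Fin n → ℕ → A} {pos : Fin n → ℕ} {out : List A}

theorem next_of_trans {s : T.State} {W : Fin 4 → Tape (Option Γ')}
    {a : Type2Action A T.State (Option Γ') n 4}
    (h : T.trans s (fun j => p j (pos j)) (fun r => (W r).head) = some a) :
    T.machine.Next p (T.tapeCfg s pos W out)
      (T.tapeCfg a.next (fun j => if a.advance j then pos j + 1 else pos j)
        (fun r => writeMove (a.work r) (W r)) (out ++ a.emit.toList)) :=
  congrArg (Option.map _) h

theorem next_onTape {s s' : T.State} {W : Fin 4 → Tape (Option Γ')} {r : Fin 4}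
    {x : Option Γ' × Option Dir}
    (h : T.trans s (fun j => p j (pos j)) (fun r => (W r).head) =
      some (T.onTape (fun r => (W r).head) s' r x)) :
    T.machine.Next p (T.tapeCfg s pos W out)
      (T.tapeCfg s' pos (Function.update W r (writeMove x (W r))) out) := by
  have hW : Function.update W r (writeMove x (W r)) =
      fun r' => writeMove (if r' = r then x else ((W r').head, none)) (W r') := by
    funext r'
    by_cases hr : r' = r
    · subst hr
      simp
    · simp [hr, writeMove_head]
  simpa [onTape, hW] using next_of_trans (out := out) h

theorem next_idle {s s' : T.State} {W : Fin 4 → Tape (Option Γ')}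
    (h : T.trans s (fun j => p j (pos j)) (fun r => (W r).head) =
      some (T.idle (fun r => (W r).head) s')) :
    T.machine.Next p (T.tapeCfg s pos W out) (T.tapeCfg s' pos W out) := by
  simpa only [writeMove_head, Function.update_eq_self] using next_onTape (out := out) h

variable {x q : StackStmt} {i : ZMod m} {v : Option Γ'} {stk : K' → List Γ'} {k : K'}

theorem reaches_push {f : Option Γ' → Γ'} (hx : .push k f q ∈ T.support) :
    Relation.ReflTransGen (T.machine.Next p)
      (T.cfg (i, some (none, v, T.wrap (.push k f q))) pos stk out)
      (T.cfg (i, some (none, v, T.wrap q)) pos (Function.update stk k (f v :: stk k)) out) := by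
  have h₁ := next_onTape (p := p) (pos := pos) (out := out) (W := stackTapes stk)
    (trans_of_mem_support hx i v _ _)
  have h₂ := next_onTape (T := T) (p := p) (pos := pos) (out := out)
    (s := (i, some (some (k, f v), v, T.wrap q)))
    (W := Function.update (stackTapes stk) (tapeEquiv k)
      (writeMove ((stk k).head?, some .left) (stackTape (stk k)))) rfl
  rw [Function.update_self, Function.update_idem, writeMove_push, ← stackTapes_update] at h₂
  refine .head ?_ (.single h₂)
  simpa [cfg, exec, stackTapes] using h₁

theorem next_pop {f : Option Γ' → Option Γ' → Option Γ'} (hx : .pop k f q ∈ T.support) :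
    T.machine.Next p (T.cfg (i, some (none, v, T.wrap (.pop k f q))) pos stk out)
      (T.cfg (i, some (none, f v (stk k).head?, T.wrap q)) pos
        (Function.update stk k (stk k).tail) out) := by
  have h := next_onTape (p := p) (pos := pos) (out := out) (W := stackTapes stk)
    (trans_of_mem_support hx i v _ _)
  simpa [cfg, stackTapes_update, ← writeMove_pop, stackTapes] using h

theorem next_of_exec_eq_idle (hx : x ∈ T.support) {s : T.State}
    (h : T.exec i v (fun r => (stk (tapeEquiv.symm r)).head?) x =
      T.idle (fun r => (stk (tapeEquiv.symm r)).head?) s) :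
    T.machine.Next p (T.cfg (i, some (none, v, T.wrap x)) pos stk out) (T.cfg s pos stk out) := by
  refine next_idle ?_
  rw [trans_of_mem_support hx, Option.some.injEq]
  simpa only [stackTapes, stackTape_head] using h

theorem reaches_stepAux (hx : x ∈ T.support) (i : ZMod m) (v : Option Γ') (stk : K' → List Γ') :
    Relation.ReflTransGen (T.machine.Next p) (T.cfg (i, some (none, v, T.wrap x)) pos stk out)
      (T.cfg (T.stateOf i (TM2.stepAux x v stk)) pos (TM2.stepAux x v stk).stk out) := by
  induction x generalizing v stk with
  | push k f q ih =>
    exact (reaches_push hx).trans (ih (mem_support_of_mem_stmts₁ hx) _ _)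
  | peek k f q ih =>
    refine .head (next_of_exec_eq_idle hx ?_) (ih (mem_support_of_mem_stmts₁ hx) _ _)
    simp [exec]
  | pop k f q ih =>
    exact .head (next_pop hx) (ih (mem_support_of_mem_stmts₁ hx) _ _)
  | load f q ih =>
    exact .head (next_of_exec_eq_idle hx rfl)
      (ih (mem_support_of_mem_stmts₁ hx) _ _)
  | branch f q₁ q₂ ih₁ ih₂ =>
    refine .head (next_of_exec_eq_idle hx rfl) ?_
    rw [TM2.stepAux]
    cases f v
    · exact ih₂ (mem_support_of_mem_stmts₁ hx) _ _
    · exact ih₁ (mem_support_of_mem_stmts₁ hx) _ _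
  | goto f => exact .single (next_of_exec_eq_idle hx rfl)
  | halt => exact .single (next_of_exec_eq_idle hx rfl)

theorem reaches_of_stackReaches {c c' : StackCfg} (h : StateTransition.Reaches (TM2.step tr) c c')
    (hc : ∀ l, c.l = some l → tr l ∈ T.support) :
    Relation.ReflTransGen (T.machine.Next p) (T.cfg (T.stateOf i c) pos c.stk out)
      (T.cfg (T.stateOf i c') pos c'.stk out) := by
  induction h using Relation.ReflTransGen.head_induction_on with
  | refl => exact .refl
  | @head c d h _ ih =>
    obtain ⟨_ | l, v, stk⟩ := c
    · simp [TM2.step] at h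
    · obtain rfl : TM2.stepAux (tr l) v stk = d := by simpa [TM2.step] using h
      exact (reaches_stepAux (hc l rfl) i v stk).trans
        (ih fun l' hl' => mem_support_of_stepAux (hc l rfl) hl')

theorem transGen_round {v v' : List ℕ}
    (h : (T.code (fun j => p j (pos j)) (i + 1)).eval v = pure v') :
    Relation.TransGen (T.machine.Next p)
      (T.cfg (i, none) pos (K'.elim (trList v) [] [] []) out)
      (T.cfg (i + 1, none) (fun j => pos j + 1) (K'.elim (trList v') [] [] [])
        (out ++ if (trList v).head? = some Γ'.bit1 then [T.letter i] else [])) := by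
  have halts : halt v' ∈ StateTransition.eval (TM2.step tr)
      (init (T.code (fun j => p j (pos j)) (i + 1)) v) := by
    rw [tr_eval, h]
    exact (Part.mem_map_iff _).2 ⟨v', Part.mem_some _, rfl⟩
  have start := next_of_trans (T := T) (p := p) (pos := pos) (out := out) (s := (i, none))
    (W := stackTapes (K'.elim (trList v) [] [] [])) rfl
  have emit : (if (trList v).head? = some Γ'.bit1 then [T.letter i] else []) =
      (if (stackTape (trList v)).head = some Γ'.bit1 then some (T.letter i) else none).toList := by
    rw [stackTape_head]
    split_ifs <;> rfl
  rw [emit]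
  refine .head' start (reaches_of_stackReaches (i := i + 1) (pos := fun j => pos j + 1)
    (StateTransition.mem_eval.1 halts).1 ?_)
  rintro l ⟨⟩
  exact T.start_mem_support _ _

theorem head?_trNum (b : Num) (l : List Γ') :
    (trNum b ++ Γ'.cons :: l).head? = some Γ'.bit1 ↔ (b : ℕ) % 2 = 1 := by
  rcases b with _ | _ | b | b
  · simp [trNum]
  · simp [trNum, trPosNum]
  · have h : ((b : ℕ) + b + 1) % 2 = 1 := by omega
    simpa [trNum, trPosNum] using h
  · have h : ((b : ℕ) + b) % 2 = 0 := by omega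
    simpa [trNum, trPosNum] using h

theorem head?_trList (v : List ℕ) : (trList v).head? = some Γ'.bit1 ↔ v.headI % 2 = 1 := by
  cases v with
  | nil => simp
  | cons a v =>
    rw [trList, trNat, head?_trNum, List.headI_cons]
    simp

theorem exists_code_of_primrec {f : ℕ → ℕ} (hf : Primrec f) :
    ∃ c : ToPartrec.Code, ∀ v, c.eval v = pure [f v.headI] := by
  obtain ⟨c, hc⟩ := ToPartrec.Code.exists_code
    (Nat.Partrec'.part_iff₁.2 (show Partrec (fun a => Part.some (f a)) from hf.to_comp.partrec))
  refine ⟨c.comp ToPartrec.Code.head, fun v => ?_⟩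
  have h : c.eval [v.headI] = pure [f v.headI] :=
    (hc (v.headI ::ᵥ List.Vector.nil)).trans (Part.map_some _ _)
  simp only [ToPartrec.Code.comp_eval, ToPartrec.Code.head_eval]
  exact (Part.bind_some _ _).trans h

theorem exists_run_eq_cfg {f : (Fin n → A) → ZMod m → ℕ → ℕ}
    (hf : ∀ a i v, (T.code a i).eval v = pure [f a i v.headI]) (p : Fin n → ℕ → A) (N : ℕ) :
    ∃ t v, N ≤ t ∧ v.headI = memory f p N ∧
      T.machine.run p t = some (T.cfg (N, none) (fun _ => N) (K'.elim (trList v) [] [] [])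
        (written f T.letter p N)) := by
  induction N with
  | zero =>
    refine ⟨0, [], le_rfl, rfl, congrArg some ?_⟩
    change T.tapeCfg _ _ _ _ = T.tapeCfg _ _ _ _
    congr 1
    · exact congrArg (·, none) Nat.cast_zero.symm
    · funext r
      fin_cases r <;> rfl
  | succ N ih =>
    obtain ⟨t, v, hNt, hv, hrun⟩ := ih
    obtain ⟨t', htt, hrun'⟩ := Type2Machine.exists_run_of_transGen
      (transGen_round (hf (fun j => p j N) (N + 1) v)) hrun
    refine ⟨t', [f (fun j => p j N) (N + 1) v.headI], by omega, congrArg (f _ _) hv, ?_⟩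
    simpa only [head?_trList, hv, written, Nat.cast_add, Nat.cast_one] using hrun'

end CodeTransducer

theorem exists_type2Machine_written {A : Type} [Finite A] {n m : ℕ} [NeZero m]
    {f : (Fin n → A) → ZMod m → ℕ → ℕ} (hf : ∀ a i, Primrec (f a i)) (letter : ZMod m → A) :
    ∃ M : Type2Machine A n, ∀ p N, ∃ t c, N ≤ t ∧ M.run p t = some c ∧
      c.out = CodeTransducer.written f letter p N := by
  choose code hcode using fun a i => CodeTransducer.exists_code_of_primrec (hf a i)
  refine ⟨CodeTransducer.machine ⟨code, letter⟩, fun p N => ?_⟩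
  obtain ⟨t, v, hNt, -, hrun⟩ := CodeTransducer.exists_run_eq_cfg (T := ⟨code, letter⟩) hcode p N
  exact ⟨t, _, hNt, hrun, rfl⟩

/-! ## Type-2 machines from primitive recursive functions on words -/

section Dovetail

variable {A : Type} {n m : ℕ} {φ : List (Fin n → A) → List A} {letter : ZMod m → A}
  {p : Fin n → ℕ → A} {q : ℕ → A}

/-- The word obtained from the approximations `φ (columns p N)` by testing, in round `N`, only
whether the next letter is `letter N`. -/
def dovetail [DecidableEq A] (φ : List (Fin n → A) → List A) (letter : ZMod m → A)
    (p : Fin n → ℕ → A) : ℕ → List A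
  | 0 => []
  | N + 1 => dovetail φ letter p N ++
      if (φ (columns p (N + 1)))[(dovetail φ letter p N).length]? = some (letter (N + 1))
        then [letter (N + 1)] else []

theorem seqPrefix_dovetail [DecidableEq A] (hq : ∀ N, SeqPrefix (φ (columns p N)) q) (N : ℕ) :
    SeqPrefix (dovetail φ letter p N) q := by
  induction N with
  | zero => exact .nil q
  | succ N ih =>
    rw [dovetail]
    split_ifs with h
    · exact ih.concat (hq _ _ _ h)
    · simpa using ih

theorem monotone_length_dovetail [DecidableEq A] :
    Monotone fun N => (dovetail φ letter p N).length :=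
  monotone_nat_of_le_succ fun N => by simp [dovetail]

theorem exists_natCast_succ_eq [NeZero m] (i : ZMod m) (B : ℕ) :
    ∃ N ≥ B, (N + 1 : ZMod m) = i := by
  refine ⟨B * m + (i - 1).val, ?_, by simp⟩
  exact (Nat.le_mul_of_pos_right B (NeZero.pos m)).trans (Nat.le_add_right _ _)

theorem exists_le_length_dovetail [DecidableEq A] [NeZero m] (hl : Function.Surjective letter)
    (hq : ∀ N, SeqPrefix (φ (columns p N)) q)
    (hlen : ∀ K, ∃ N₀, ∀ N ≥ N₀, K ≤ (φ (columns p N)).length) (K : ℕ) :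
    ∃ N, K ≤ (dovetail φ letter p N).length := by
  induction K with
  | zero => exact ⟨0, Nat.zero_le _⟩
  | succ K ih =>
    obtain ⟨N₁, hN₁⟩ := ih
    obtain ⟨N₀, hN₀⟩ := hlen (K + 1)
    obtain ⟨i, hi⟩ := hl (q K)
    obtain ⟨N, hN, rfl⟩ := exists_natCast_succ_eq i (N₀ + N₁)
    have hK : K ≤ (dovetail φ letter p N).length :=
      hN₁.trans (monotone_length_dovetail (by omega))
    obtain hK | hK := hK.lt_or_eq
    · exact ⟨N, hK⟩
    · have hletter := (hq (N + 1)).getElem?_eq (hN₀ (N + 1) (by omega))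
      refine ⟨N + 1, ?_⟩
      simp [dovetail, ← hK, hletter, hi]

variable [Primcodable A]

/-- The number stored by a machine that has read the word `x.1` and, including the letter that is
due at the beginning of the next round if `b = 1`, written `x.2` letters. -/
def packMemory (x : List (Fin n → A) × ℕ) (b : ℕ) : ℕ :=
  2 * @Encodable.encode _ Primcodable.toEncodable x + b

/-- The first argument of `packMemory`, recovered from its value. -/
def unpackMemory (s : ℕ) : List (Fin n → A) × ℕ :=
  (@Encodable.decode _ Primcodable.toEncodable (s / 2)).getD ([], 0)

theorem packMemory_mod_two (x : List (Fin n → A) × ℕ) {b : ℕ} (hb : b ≤ 1) :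
    packMemory x b % 2 = b := by
  rw [packMemory]
  omega

theorem unpackMemory_packMemory (x : List (Fin n → A) × ℕ) {b : ℕ} (hb : b ≤ 1) :
    unpackMemory (packMemory x b) = x := by
  have h : packMemory x b / 2 = @Encodable.encode _ Primcodable.toEncodable x := by
    rw [packMemory]
    omega
  rw [unpackMemory, h, @Encodable.encodek _ Primcodable.toEncodable, Option.getD_some]

variable [DecidableEq A]

/-- The transformation of the memory that implements `dovetail`. -/
def updateMemory (φ : List (Fin n → A) → List A) (letter : ZMod m → A) (a : Fin n → A)
    (i : ZMod m) (s : ℕ) : ℕ :=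
  let x := unpackMemory (A := A) (n := n) s
  let b := if (φ (x.1 ++ [a]))[x.2]? = some (letter i) then 1 else 0
  packMemory (x.1 ++ [a], x.2 + b) b

theorem primrec_updateMemory (hφ : Primrec φ) (a : Fin n → A) (i : ZMod m) :
    Primrec (updateMemory φ letter a i) := by
  have unpack : Primrec (unpackMemory (A := A) (n := n)) :=
    Primrec.option_getD.comp ((Primrec.decode (α := List (Fin n → A) × ℕ)).comp
      (Primrec.nat_div.comp .id (.const 2))) (.const ([], 0))
  have word : Primrec fun s => (unpackMemory (A := A) s).1 ++ [a] :=
    Primrec.list_concat.comp (Primrec.fst.comp unpack) (.const a)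
  have count : Primrec fun s => (unpackMemory (A := A) (n := n) s).2 := Primrec.snd.comp unpack
  have bit : Primrec fun s => if (φ ((unpackMemory s).1 ++ [a]))[(unpackMemory (A := A)
      (n := n) s).2]? = some (letter i) then 1 else 0 :=
    Primrec.ite (Primrec.eq.comp (Primrec.list_getElem?.comp (hφ.comp word) count) (.const _))
      (.const 1) (.const 0)
  exact Primrec.nat_add.comp (Primrec.nat_double.comp (Primrec.encode.comp
    (Primrec.pair word (Primrec.nat_add.comp count bit)))) bit

-- What is written lags one round behind `dovetail`, the lag being recorded by the bit `b`.
theorem memory_updateMemory (N : ℕ) : ∃ b ≤ 1,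
    CodeTransducer.memory (updateMemory φ letter) p N =
        packMemory (columns p N, (dovetail φ letter p N).length) b ∧
    dovetail φ letter p N = CodeTransducer.written (updateMemory φ letter) letter p N ++
      if b = 1 then [letter N] else [] := by
  induction N with
  | zero => exact ⟨0, Nat.zero_le _, rfl, rfl⟩
  | succ N ih =>
    obtain ⟨b, hb, hmem, hout⟩ := ih
    have lag : CodeTransducer.written (updateMemory φ letter) letter p (N + 1) =
        dovetail φ letter p N := by
      rw [CodeTransducer.written, hmem, packMemory_mod_two _ hb, hout]
    refine ⟨if (φ (columns p (N + 1)))[(dovetail φ letter p N).length]? = some (letter (N + 1))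
      then 1 else 0, by split_ifs <;> simp, ?_, ?_⟩
    · rw [CodeTransducer.memory, hmem, updateMemory, unpackMemory_packMemory _ hb, dovetail,
        columns_succ]
      split_ifs <;> simp
    · rw [lag, dovetail]
      split_ifs <;> simp_all

theorem written_updateMemory_succ (N : ℕ) :
    CodeTransducer.written (updateMemory φ letter) letter p (N + 1) = dovetail φ letter p N := by
  obtain ⟨b, hb, hmem, hout⟩ := memory_updateMemory (φ := φ) (letter := letter) (p := p) N
  rw [CodeTransducer.written, hmem, packMemory_mod_two _ hb, hout]

end Dovetail

theorem exists_type2Machine_of_primrec {A : Type} [Finite A] [Nonempty A] [Primcodable A] {n : ℕ}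
    {φ : List (Fin n → A) → List A} (hφ : Primrec φ) :
    ∃ M : Type2Machine A n, ∀ p q, (∀ N, SeqPrefix (φ (columns p N)) q) →
      (∀ K, ∃ N₀, ∀ N ≥ N₀, K ≤ (φ (columns p N)).length) → q ∈ M.seqFun p := by
  classical
  have : NeZero (Nat.card A) := ⟨Nat.card_pos.ne'⟩
  obtain ⟨letter, hl⟩ : ∃ f : ZMod (Nat.card A) → A, Function.Surjective f :=
    ⟨_, ((Finite.equivFinOfCardEq (Nat.card_zmod _)).trans (Finite.equivFin A).symm).surjective⟩
  obtain ⟨M, hM⟩ := exists_type2Machine_written (primrec_updateMemory (letter := letter) hφ) letter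
  refine ⟨M, fun p q hq hlen => ?_⟩
  have run (N : ℕ) : ∃ t c, N ≤ t ∧ M.run p t = some c ∧ c.out = dovetail φ letter p N := by
    obtain ⟨t, c, hN, hrun, hout⟩ := hM p (N + 1)
    exact ⟨t, c, by omega, hrun, hout.trans (written_updateMemory_succ N)⟩
  refine Type2Machine.mem_seqFun_of_frequently (fun N => ?_) fun K => ?_
  · obtain ⟨t, c, hN, hrun, hout⟩ := run N
    exact ⟨t, c, hN, hrun, hout ▸ seqPrefix_dovetail hq N⟩
  · obtain ⟨N, hK⟩ := exists_le_length_dovetail hl hq hlen K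
    obtain ⟨t, c, -, hrun, hout⟩ := run N
    exact ⟨t, c, hrun, hout ▸ hK⟩

/-! ## Approximation -/

/-- A notion of approximation of the elements of `C` by data in `D`: `rel K d c` says that `d`
approximates `c` at least up to level `K`. -/
structure ApproxRel (D : Type*) (C : Type*) where
  rel : ℕ → D → C → Prop
  mono : ∀ {K K' d c}, K' ≤ K → rel K d c → rel K' d c

namespace ApproxRel

/-- The approximation of words by themselves, or of elements of any other type. -/
def discrete (C : Type*) : ApproxRel C C where
  rel _ d c := d = c
  mono _ h := h

/-- The approximation of infinite sequences by their prefixes of length at least `K`. -/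
def prefixes (A : Type*) : ApproxRel (List A) (ℕ → A) where
  rel K w q := SeqPrefix w q ∧ K ≤ w.length
  mono hK h := ⟨h.1, hK.trans h.2⟩

/-- The componentwise approximation of tuples of infinite sequences by prefixes. -/
def tuples (A ι : Type*) : ApproxRel (ι → List A) (ι → ℕ → A) where
  rel K ws p := ∀ j, (prefixes A).rel K (ws j) (p j)
  mono hK h j := (prefixes A).mono hK (h j)

end ApproxRel

/-- The partial functions `E N`, which for `N → ∞` are given increasing resources, transform
approximations of `c` into approximations of `c'`: each value is a correct approximation, and every
level is reached if `N` is large and the approximation of `c` is good. -/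
structure Tracks {D C D' C' : Type*} (R : ApproxRel D C) (R' : ApproxRel D' C')
    (E : ℕ → D → Option D') (c : C) (c' : C') : Prop where
  sound : ∀ {N d d'}, R.rel 0 d c → d' ∈ E N d → R'.rel 0 d' c'
  exists_level : ∀ K, ∃ T, ∀ N ≥ T, ∀ d, R.rel T d c → ∃ d' ∈ E N d, R'.rel K d' c'

namespace Tracks

variable {D C D' C' D'' C'' : Type*} {R : ApproxRel D C} {R' : ApproxRel D' C'}
  {R'' : ApproxRel D'' C''} {E : ℕ → D → Option D'} {E' : ℕ → D' → Option D''} {c : C} {c' : C'}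
  {c'' : C''}

theorem of_forall {e : D → Option D'} (h : ∀ K d, R.rel K d c → ∃ d' ∈ e d, R'.rel K d' c') :
    Tracks R R' (fun _ => e) c c' where
  sound hd hd' := by
    obtain ⟨d'', hd'', hrel⟩ := h 0 _ hd
    rwa [Option.mem_unique hd' hd'']
  exists_level K := ⟨K, fun _ _ => h K⟩

theorem of_map {f : D → D'} (h : ∀ K d, R.rel K d c → R'.rel K (f d) c') :
    Tracks R R' (fun _ d => some (f d)) c c' :=
  of_forall fun K d hd => ⟨_, rfl, h K d hd⟩

theorem comp (h : Tracks R R' E c c') (h' : Tracks R' R'' E' c' c'') :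
    Tracks R R'' (fun N d => (E N d).bind (E' N)) c c'' where
  sound hd hd'' := by
    obtain ⟨d', hd', hd''⟩ := Option.bind_eq_some_iff.1 hd''
    exact h'.sound (h.sound hd hd') hd''
  exists_level K := by
    obtain ⟨T', hT'⟩ := h'.exists_level K
    obtain ⟨T, hT⟩ := h.exists_level T'
    refine ⟨max T T', fun N hN d hd => ?_⟩
    obtain ⟨d', hd', hrel'⟩ := hT N (le_of_max_le_left hN) d (R.mono (le_max_left _ _) hd)
    obtain ⟨d'', hd'', hrel''⟩ := hT' N (le_of_max_le_right hN) d' hrel'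
    exact ⟨d'', Option.bind_eq_some_iff.2 ⟨d', hd', hd''⟩, hrel''⟩

theorem map₂ (h : Tracks R R' E c c') {g : D → D' → D''}
    (hg : ∀ K d d', R.rel K d c → R'.rel K d' c' → R''.rel K (g d d') c'') :
    Tracks R R'' (fun N d => (E N d).map (g d)) c c'' where
  sound hd hd'' := by
    obtain ⟨d', hd', rfl⟩ := Option.map_eq_some_iff.1 hd''
    exact hg 0 _ d' hd (h.sound hd hd')
  exists_level K := by
    obtain ⟨T, hT⟩ := h.exists_level K
    refine ⟨max T K, fun N hN d hd => ?_⟩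
    obtain ⟨d', hd', hrel⟩ := hT N (le_of_max_le_left hN) d (R.mono (le_max_left _ _) hd)
    exact ⟨_, Option.map_eq_some_iff.2 ⟨d', hd', rfl⟩,
      hg K d d' (R.mono (le_max_right _ _) hd) hrel⟩

theorem congr {F : ℕ → D → Option D'} (h : Tracks R R' E c c')
    (hE : ∀ N d, R.rel 0 d c → F N d = E N d) : Tracks R R' F c c' where
  sound hd hd' := h.sound hd (hE _ _ hd ▸ hd')
  exists_level K := by
    obtain ⟨T, hT⟩ := h.exists_level K
    exact ⟨T, fun N hN d hd => hE N d (R.mono T.zero_le hd) ▸ hT N hN d hd⟩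

end Tracks

/-! ## Primitive recursion on finite types -/

/-- A primitive recursive coding of a finite type. -/
@[reducible] noncomputable def finitePrimcodable (α : Type*) [Finite α] : Primcodable α :=
  Primcodable.ofEquiv (Fin (Nat.card α)) (Finite.equivFin α)

theorem primrec₂_of_finite {ι α σ : Type*} [Finite ι] [Primcodable ι] [Primcodable α]
    [Primcodable σ] {f : ι → α → σ} (hf : ∀ i, Primrec (f i)) : Primrec₂ f := by
  have e := Finite.equivFin ι
  have h : Primrec₂ fun k => f (e.symm k) := Primrec.fin_curry₁.2 fun k => hf _
  refine (h.comp (g := fun x : ι × α => e x.1) (h := fun x => x.2)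
    ((Primrec.dom_finite e).comp .fst) .snd).of_eq fun x => ?_
  simp

theorem primrec_apply {n : ℕ} {α σ : Type*} [Primcodable α] [Primcodable σ] {f : α → Fin n → σ}
    (hf : Primrec f) (j : Fin n) : Primrec fun a => f a j :=
  Primrec.fin_app.comp hf (.const j)

theorem primrec_pi {n : ℕ} {α σ : Type*} [Primcodable α] [Primcodable σ] {f : α → Fin n → σ}
    (hf : ∀ j, Primrec fun a => f a j) : Primrec f :=
  Primrec.fin_curry.2 (Primrec₂.swap (Primrec.fin_curry₁.2 hf))

/-! ## Simulating a Type-2 machine on finite prefixes of its input -/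

namespace Type2Machine

open Turing

variable {A : Type} {n : ℕ} (M : Type2Machine A n)

/-- Configurations in which a tape is given by the scanned symbol and the words to the left and to
the right of the head: state, positions of the input heads, work tapes, and output. They are tuples
since this makes them primitively codable. -/
abbrev WordCfg : Type :=
  M.State × (Fin n → ℕ) × (Fin M.m → M.Work × List M.Work × List M.Work) × List A

/-- What a machine sees: its state, the input symbols (if available) and the work symbols. -/
abbrev View : Type := M.State × (Fin n → Option A) × (Fin M.m → M.Work)

variable {M}

namespace WordCfg

/-- The state. -/
abbrev state (c : M.WordCfg) : M.State := c.1

/-- The positions of the input heads. -/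
abbrev pos (c : M.WordCfg) : Fin n → ℕ := c.2.1

/-- The work tapes. -/
abbrev tapes (c : M.WordCfg) : Fin M.m → M.Work × List M.Work × List M.Work := c.2.2.1

/-- The output. -/
abbrev out (c : M.WordCfg) : List A := c.2.2.2

/-- What the machine sees if only the prefixes `ws` of the input are available. -/
def view (ws : Fin n → List A) (c : M.WordCfg) : M.View :=
  (c.state, fun j => (ws j)[c.pos j]?, fun r => (c.tapes r).1)

/-- The configuration represented by a configuration on words. -/
def toCfg (c : M.WordCfg) : M.Cfg where
  state := c.state
  pos := c.pos
  work r := ⟨(c.tapes r).1, ListBlank.mk (c.tapes r).2.1, ListBlank.mk (c.tapes r).2.2⟩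
  out := c.out

end WordCfg

namespace View

/-- All input symbols are available. -/
def Complete (κ : M.View) : Prop := ∀ j, (κ.2.1 j).isSome

open scoped Classical in
/-- The action taken, if all input symbols are available and the machine does not halt. -/
noncomputable def action (κ : M.View) : Option (Type2Action A M.State M.Work n M.m) :=
  if h : κ.Complete then M.trans κ.1 (fun j => (κ.2.1 j).get (h j)) κ.2.2 else none

theorem complete_of_action {κ : M.View} {a : Type2Action A M.State M.Work n M.m}
    (h : κ.action = some a) : κ.Complete := by
  by_contra hκ
  simp [action, hκ] at h

end View

/-- Writing and moving on a tape given by words. -/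
def wordTapeAct {W : Type} [Inhabited W] (x : W × Option Dir) (T : W × List W × List W) :
    W × List W × List W :=
  if x.2 = none then (x.1, T.2)
  else if x.2 = some Dir.left then (T.2.1.headI, T.2.1.tail, x.1 :: T.2.2)
  else (T.2.2.headI, x.1 :: T.2.1, T.2.2.tail)

/-- A step of the simulation; nothing changes if the machine halts or if an input symbol is not
available. -/
noncomputable def wordStep (ws : Fin n → List A) (c : M.WordCfg) : M.WordCfg :=
  let a := (c.view ws).action
  (a.elim c.state fun a => a.next,
    fun j => c.pos j + a.elim 0 fun a => (a.advance j).toNat,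
    fun r => wordTapeAct (a.elim ((c.tapes r).1, none) fun a => a.work r) (c.tapes r),
    c.out ++ a.elim [] fun a => a.emit.toList)

variable (M) in
/-- The configuration after `N` steps of the simulation. -/
noncomputable def wordRun (N : ℕ) (ws : Fin n → List A) : M.WordCfg :=
  (wordStep ws)^[N] (M.start, fun _ => 0, fun _ => (default, [], []), [])

section Simulation

variable {p : Fin n → ℕ → A} {ws : Fin n → List A} {c : M.WordCfg} {N N' t T : ℕ}

theorem wordRun_succ : M.wordRun (N + 1) ws = wordStep ws (M.wordRun N ws) :=
  Function.iterate_succ_apply' _ _ _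

theorem wordStep_of_action_eq_none (h : (c.view ws).action = none) : wordStep ws c = c := by
  simp [wordStep, WordCfg.state, WordCfg.pos, WordCfg.tapes, WordCfg.out, h, wordTapeAct]

theorem toCfg_wordStep {a : Type2Action A M.State M.Work n M.m} (h : (c.view ws).action = some a) :
    (wordStep ws c).toCfg = M.act a c.toCfg := by
  simp only [wordStep, h, Option.elim_some, WordCfg.toCfg, act]
  congr 1
  · funext j
    cases ha : a.advance j <;> simp [WordCfg.pos, ha]
  · funext r
    rcases hd : (a.work r).2 with _ | d
    · simp [WordCfg.tapes, wordTapeAct, hd, Tape.write]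
    · cases d <;> simp [WordCfg.tapes, wordTapeAct, hd, Tape.write, Tape.move, ListBlank.head_mk,
        ListBlank.tail_mk, ListBlank.cons_mk]

theorem step_toCfg (hws : (ApproxRel.tuples A (Fin n)).rel 0 ws p) (h : (c.view ws).Complete) :
    M.step p c.toCfg = (c.view ws).action.map fun a => M.act a c.toCfg := by
  have scanned : (fun j => ((c.view ws).2.1 j).get (h j)) = fun j => p j (c.pos j) :=
    funext fun j => (hws j).1 (c.pos j) _ (Option.some_get (h j)).symm
  rw [View.action, dif_pos h, scanned]
  rfl

theorem exists_run_eq_wordRun (hws : (ApproxRel.tuples A (Fin n)).rel 0 ws p) (N : ℕ) :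
    ∃ t, M.run p t = some (M.wordRun N ws).toCfg := by
  induction N with
  | zero => exact ⟨0, rfl⟩
  | succ N ih =>
    obtain ⟨t, ht⟩ := ih
    rw [wordRun_succ]
    rcases ha : ((M.wordRun N ws).view ws).action with _ | a
    · exact ⟨t, by rw [wordStep_of_action_eq_none ha, ht]⟩
    · refine ⟨t + 1, ?_⟩
      rw [run, ht, Option.bind_some, step_toCfg hws (View.complete_of_action ha), ha,
        toCfg_wordStep ha, Option.map_some]

theorem pos_le_of_run {c : M.Cfg} (h : M.run p t = some c) (j : Fin n) : c.pos j ≤ t := by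
  induction t generalizing c with
  | zero =>
    obtain rfl : M.init = c := Option.some.inj h
    exact le_rfl
  | succ t ih =>
    simp only [run, step, Option.bind_eq_some_iff, Option.map_eq_some_iff] at h
    obtain ⟨d, hd, a, _, rfl⟩ := h
    have := ih hd
    simp only [act]
    split_ifs <;> omega

theorem complete_view_of_run (hws : (ApproxRel.tuples A (Fin n)).rel (t + 1) ws p)
    (h : M.run p t = some c.toCfg) : (c.view ws).Complete := fun j => by
  have : c.pos j < (ws j).length := (pos_le_of_run h j).trans_lt (hws j).2
  simpa [WordCfg.view] using this

theorem toCfg_wordRun (hws : (ApproxRel.tuples A (Fin n)).rel T ws p) {c : M.Cfg}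
    (h : M.run p T = some c) : (M.wordRun T ws).toCfg = c := by
  induction T generalizing c with
  | zero => exact Option.some.inj h
  | succ T ih =>
    obtain ⟨d, hd, hs⟩ := Option.bind_eq_some_iff.1 h
    obtain rfl := ih ((ApproxRel.tuples A _).mono T.le_succ hws) hd
    rw [step_toCfg ((ApproxRel.tuples A _).mono (Nat.zero_le _) hws) (complete_view_of_run hws hd),
      Option.map_eq_some_iff] at hs
    obtain ⟨a, ha, rfl⟩ := hs
    rw [wordRun_succ, toCfg_wordStep ha]

theorem monotone_length_out_wordRun (ws : Fin n → List A) :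
    Monotone fun N => (M.wordRun N ws).out.length :=
  monotone_nat_of_le_succ fun N => by simp [wordRun_succ, wordStep, WordCfg.out]

theorem wordRun_eq_of_le (h : N ≤ N') (ha : ((M.wordRun N ws).view ws).action = none) :
    M.wordRun N' ws = M.wordRun N ws := by
  induction N', h using Nat.le_induction with
  | base => rfl
  | succ N' _ ih => rw [wordRun_succ, ih, wordStep_of_action_eq_none ha]

end Simulation

section Primrec

variable [Primcodable A] [Primcodable M.State] [Primcodable M.Work] {α : Type*} [Primcodable α]

theorem primrec_wordTapeAct {W : Type} [Inhabited W] [Primcodable W] [Primcodable (Option Dir)]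
    {x : α → W × Option Dir} {T : α → W × List W × List W}
    (hx : Primrec x) (hT : Primrec T) : Primrec fun a => wordTapeAct (x a) (T a) := by
  classical
  have symbol := Primrec.fst.comp hx
  have dir := Primrec.snd.comp hx
  have before := Primrec.fst.comp (Primrec.snd.comp hT)
  have after := Primrec.snd.comp (Primrec.snd.comp hT)
  exact (Primrec.ite (Primrec.eq.comp dir (.const none))
    (.pair symbol (Primrec.snd.comp hT))
    (Primrec.ite (Primrec.eq.comp dir (.const (some Dir.left)))
      (.pair (Primrec.list_headI.comp before)
        (.pair (Primrec.list_tail.comp before) (Primrec.list_cons.comp symbol after)))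
      (.pair (Primrec.list_headI.comp after)
        (.pair (Primrec.list_cons.comp symbol before) (Primrec.list_tail.comp after))))).of_eq
    fun a => by simp only [wordTapeAct]

theorem primrec_pos : Primrec (WordCfg.pos : M.WordCfg → _) := Primrec.fst.comp .snd

theorem primrec_tapes : Primrec (WordCfg.tapes : M.WordCfg → _) :=
  Primrec.fst.comp (Primrec.snd.comp .snd)

theorem primrec_out : Primrec (WordCfg.out : M.WordCfg → _) :=
  Primrec.snd.comp (Primrec.snd.comp .snd)

theorem primrec_view : Primrec₂ (WordCfg.view : (Fin n → List A) → M.WordCfg → _) :=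
  Primrec.pair (Primrec.fst.comp .snd) (.pair
    (primrec_pi fun j => Primrec.list_getElem?.comp (primrec_apply .fst j)
      (primrec_apply (primrec_pos.comp .snd) j))
    (primrec_pi fun r => Primrec.fst.comp (primrec_apply (primrec_tapes.comp .snd) r)))

variable [Finite A]

theorem primrec_wordStep : Primrec₂ (wordStep : (Fin n → List A) → M.WordCfg → _) := by
  have := M.stateFinite
  have := M.workFinite
  have : Finite Dir := Finite.of_injective (fun d => decide (d = Dir.left)) (by
    intro a b; cases a <;> cases b <;> simp)
  let : Primcodable Dir := finitePrimcodable Dir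
  refine Primrec.pair ?_ (.pair (primrec_pi fun j => ?_) (.pair (primrec_pi fun r => ?_) ?_))
  · exact (Primrec.dom_finite fun κ : M.View => κ.action.elim κ.1 fun a => a.next).comp primrec_view
  · exact Primrec.nat_add.comp (primrec_apply (primrec_pos.comp .snd) j) ((Primrec.dom_finite
      fun κ : M.View => κ.action.elim 0 fun a => (a.advance j).toNat).comp primrec_view)
  · exact primrec_wordTapeAct ((Primrec.dom_finite fun κ : M.View =>
      κ.action.elim (κ.2.2 r, none) fun a => a.work r).comp primrec_view)
      (primrec_apply (primrec_tapes.comp .snd) r)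
  · exact Primrec.list_append.comp (primrec_out.comp .snd) ((Primrec.dom_finite
      fun κ : M.View => κ.action.elim [] fun a => a.emit.toList).comp primrec_view)

theorem primrec_wordRun : Primrec₂ M.wordRun :=
  Primrec.nat_iterate Primrec.fst (.const _)
    (Primrec₂.comp primrec_wordStep (Primrec.snd.comp .fst) .snd)

end Primrec

variable (M) [Primcodable A] [Finite A]

theorem exists_primrec_tracks_seqFun : ∃ Φ : ℕ → (Fin n → List A) → Option (List A),
    Primrec₂ Φ ∧ ∀ p, ∀ q ∈ M.seqFun p, Tracks (.tuples A (Fin n)) (.prefixes A) Φ p q := by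
  have := M.stateFinite
  have := M.workFinite
  let := finitePrimcodable M.State
  let := finitePrimcodable M.Work
  have seqPrefix_out {p q} (hq : q ∈ M.seqFun p) {ws}
      (hws : (ApproxRel.tuples A _).rel 0 ws p) (N) : SeqPrefix (M.wordRun N ws).out q := by
    obtain ⟨t, ht⟩ := exists_run_eq_wordRun (M := M) hws N
    obtain ⟨c, hc, hout⟩ := hq.1 t
    obtain rfl := Option.some.inj (ht.symm.trans hc)
    exact SeqPrefix.iff_eq_map_range.2 hout
  refine ⟨fun N ws => some (M.wordRun N ws).out,
    Primrec.option_some.comp (primrec_out.comp primrec_wordRun), fun p q hq =>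
      ⟨fun {N ws w} hws hw => ?_, fun K => ?_⟩⟩
  · obtain rfl := Option.some.inj hw
    exact ⟨seqPrefix_out hq hws N, Nat.zero_le _⟩
  · obtain ⟨T, c, hc, hK⟩ := hq.2 K
    refine ⟨T, fun N hN ws hws => ⟨_, rfl, ?_, ?_⟩⟩
    · exact seqPrefix_out hq ((ApproxRel.tuples A _).mono (Nat.zero_le _) hws) N
    · rw [← toCfg_wordRun hws hc] at hK
      exact hK.trans (monotone_length_out_wordRun ws hN)

theorem exists_primrec_tracks_wordFun : ∃ Ψ : ℕ → (Fin n → List A) → Option (List A),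
    Primrec₂ Ψ ∧ ∀ p, ∀ w ∈ M.wordFun p, Tracks (.tuples A (Fin n)) (.discrete (List A)) Ψ p w := by
  classical
  have := M.stateFinite
  have := M.workFinite
  let := finitePrimcodable M.State
  let := finitePrimcodable M.Work
  let halted (κ : M.View) : Bool := decide (κ.Complete ∧ κ.action = none)
  refine ⟨fun N ws => if halted ((M.wordRun N ws).view ws) = true then
    some (M.wordRun N ws).out else none, ?_, fun p w hw =>
      ⟨fun {N ws w'} hws hw' => ?_, fun _ => ?_⟩⟩
  · exact Primrec.ite (Primrec.eq.comp ((Primrec.dom_finite halted).comp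
      (Primrec₂.comp primrec_view .snd primrec_wordRun)) (.const true))
      (Primrec.option_some.comp (primrec_out.comp primrec_wordRun)) (.const none)
  · rw [Option.mem_def] at hw'
    split_ifs at hw' with hhalted
    obtain ⟨complete, action_eq⟩ := of_decide_eq_true hhalted
    obtain ⟨t, ht⟩ := exists_run_eq_wordRun (M := M) hws N
    refine M.wordFun_isPartialFun p ⟨t, _, ht, ?_, Option.some.inj hw'⟩ hw
    rw [step_toCfg hws complete, action_eq, Option.map_none]
  · obtain ⟨t, c, hc, hs, rfl⟩ := hw
    refine ⟨t + 1, fun N hN ws hws => ⟨_, ?_, rfl⟩⟩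
    obtain rfl := toCfg_wordRun ((ApproxRel.tuples A _).mono t.le_succ hws) hc
    have complete := complete_view_of_run hws hc
    rw [step_toCfg ((ApproxRel.tuples A _).mono (Nat.zero_le _) hws) complete,
      Option.map_eq_none_iff] at hs
    rw [wordRun_eq_of_le (t.le_succ.trans hN) hs, if_pos (decide_eq_true ⟨complete, hs⟩)]
    rfl

end Type2Machine

/-! ## Corresponding configurations -/

namespace GTM

/-- Corresponding contents of cells: the same symbol, or elements related by `ε`. -/
def CellRel {U : Type u} {V : Type v} {Γ : Type} (ε : MultiFun U V) : U ⊕ Γ → V ⊕ Γ → Prop :=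
  Sum.LiftRel (fun y z => z ∈ ε y) Eq

/-- Corresponding configurations: equal labels and heads, and corresponding contents of cells. -/
def ConfRel {F : GTMFrame} {Y : Fin (F.L + 1) → Type u} {Z : Fin (F.L + 1) → Type v}
    (δ : ∀ i, MultiFun (Y i) (Z i)) (c : Conf F Y) (d : Conf F Z) : Prop :=
  c.label = d.label ∧ c.head = d.head ∧ ∀ i m, CellRel (δ i) (c.tape i m) (d.tape i m)

section

variable {F : GTMFrame} {X : Fin (F.L + 1) → Type u}

theorem eq_of_scan_eq_inl {c : Conf F X} {n : ℕ} {t : Fin n → Fin (F.L + 1)}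
    {x x' : ∀ j, X (t j)} (hx : ∀ j, c.scan (t j) = Sum.inl (x j))
    (hx' : ∀ j, c.scan (t j) = Sum.inl (x' j)) : x = x' :=
  funext fun j => Sum.inl_injective ((hx j).symm.trans (hx' j))

theorem initConf_tape_inTape (x : ∀ j, X (F.inTape j)) (j : Fin F.k) :
    (initConf x).tape (F.inTape j) 0 = Sum.inl (x j) :=
  dif_pos ⟨j.2, rfl⟩

theorem initConf_tape_of_forall_ne (x : ∀ j, X (F.inTape j)) {i : Fin (F.L + 1)} {m : ℤ}
    (h : ∀ j, m = 0 → i ≠ F.inTape j) : (initConf x).tape i m = Sum.inr F.blank := by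
  cases i using Fin.cases with
  | zero => rfl
  | succ i => exact dif_neg fun him => h ⟨i, him.1⟩ him.2 rfl

end

namespace ConfRel

variable {F : GTMFrame} {Y : Fin (F.L + 1) → Type u} {Z : Fin (F.L + 1) → Type v}
  {δ δ' : ∀ i, MultiFun (Y i) (Z i)} {c : Conf F Y} {d : Conf F Z}

theorem mono (hδ : ∀ i y, δ i y ⊆ δ' i y) (h : ConfRel δ c d) : ConfRel δ' c d :=
  ⟨h.1, h.2.1, fun i m => (h.2.2 i m).mono (fun y _ hz => hδ i y hz) fun _ _ => id⟩

theorem initConf {y : ∀ j, Y (F.inTape j)} {z : ∀ j, Z (F.inTape j)}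
    (h : ∀ j, z j ∈ δ (F.inTape j) (y j)) : ConfRel δ (initConf y) (initConf z) := by
  refine ⟨rfl, rfl, fun i m => ?_⟩
  by_cases hi : ∃ j, m = 0 ∧ i = F.inTape j
  · obtain ⟨j, rfl, rfl⟩ := hi
    rw [initConf_tape_inTape, initConf_tape_inTape]
    exact .inl (h j)
  · have hne (j) (hm : m = 0) (hij : i = F.inTape j) : False := hi ⟨j, hm, hij⟩
    rw [initConf_tape_of_forall_ne y hne, initConf_tape_of_forall_ne z hne]
    exact .inr rfl

variable (h : ConfRel δ c d)
include h

theorem scan (i : Fin (F.L + 1)) : CellRel (δ i) (c.scan i) (d.scan i) := by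
  simp only [Conf.scan, h.2.1]
  exact h.2.2 _ _

theorem goto (l : F.Label) : ConfRel δ (c.goto l) (d.goto l) :=
  ⟨rfl, h.2⟩

theorem setHead (i : Fin (F.L + 1)) (m : ℤ) : ConfRel δ (c.setHead i m) (d.setHead i m) :=
  ⟨h.1, congrArg (Function.update (β := fun _ => ℤ) · i m) h.2.1, h.2.2⟩

theorem setCell (i : Fin (F.L + 1)) {x : Y i ⊕ F.Γ} {y : Z i ⊕ F.Γ} (hxy : CellRel (δ i) x y) :
    ConfRel δ (c.setCell i x) (d.setCell i y) := by
  refine ⟨h.1, h.2.1, fun j m => ?_⟩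
  simp only [Conf.setCell, h.2.1]
  by_cases hj : j = i
  · subst hj
    by_cases hm : m = d.head j
    · simpa only [hm, Function.update_self] using hxy
    · simpa only [Function.update_self, Function.update_of_ne hm] using h.2.2 j m
  · simpa only [Function.update_of_ne hj] using h.2.2 j m

theorem scan_eq_inr_iff (i : Fin (F.L + 1)) (a : F.Γ) :
    c.scan i = Sum.inr a ↔ d.scan i = Sum.inr a := by
  have := h.scan i
  generalize c.scan i = x, d.scan i = y at this
  rcases this with _ | ⟨rfl⟩ <;> simp

theorem exists_scan_eq_inl {n : ℕ} {t : Fin n → Fin (F.L + 1)} {z : ∀ j, Z (t j)}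
    (hz : ∀ j, d.scan (t j) = Sum.inl (z j)) :
    ∃ y : ∀ j, Y (t j), (∀ j, c.scan (t j) = Sum.inl (y j)) ∧ ∀ j, z j ∈ δ (t j) (y j) := by
  have scan_eq (j : Fin n) : ∃ y, c.scan (t j) = Sum.inl y ∧ z j ∈ δ (t j) y := by
    have := hz j ▸ h.scan (t j)
    generalize c.scan (t j) = x at this
    obtain ⟨hzy⟩ := this
    exact ⟨_, rfl, hzy⟩
  choose y hy hzy using scan_eq
  exact ⟨y, hy, hzy⟩

theorem exists_acceptsWith_left {z : Z 0} (hz : AcceptsWith d z) :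
    ∃ y, AcceptsWith c y ∧ z ∈ δ 0 y := by
  have hcell := hz.2 ▸ h.2.2 0 0
  generalize hx : c.tape 0 0 = x at hcell
  obtain ⟨hzy⟩ := hcell
  exact ⟨_, ⟨h.1.trans hz.1, hx⟩, hzy⟩

theorem exists_acceptsWith_right {y : Y 0} (hy : AcceptsWith c y) :
    ∃ z, AcceptsWith d z ∧ z ∈ δ 0 y := by
  have hcell := hy.2 ▸ h.2.2 0 0
  generalize hx : d.tape 0 0 = x at hcell
  obtain ⟨hzy⟩ := hcell
  exact ⟨_, ⟨h.1.symm.trans hy.1, hx⟩, hzy⟩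

end ConfRel

end GTM

/-! ## Approximating configurations by logs of finite words -/

theorem encode_natCast (n : ℕ) : Encodable.encode (n : ℤ) = 2 * n := rfl

theorem encode_negSucc (n : ℕ) : Encodable.encode (Int.negSucc n) = 2 * n + 1 := rfl

theorem primrec_int_add_one : Primrec fun z : ℤ => z + 1 := by
  have onCodes : Primrec fun e : ℕ => if e = 1 then 0 else if e % 2 = 0 then e + 2 else e - 2 :=
    Primrec.ite (Primrec.eq.comp .id (.const 1)) (.const 0)
      (Primrec.ite (Primrec.eq.comp (Primrec.nat_mod.comp .id (.const 2)) (.const 0))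
        (Primrec.nat_add.comp .id (.const 2)) (Primrec.nat_sub.comp .id (.const 2)))
  refine Primrec.encode_iff.1 ((onCodes.comp Primrec.encode).of_eq fun z => ?_)
  rcases z with n | _ | n
  · rw [Int.ofNat_eq_natCast, ← Nat.cast_add_one, encode_natCast, encode_natCast,
      if_neg (by omega), if_pos (by omega)]
    omega
  · rfl
  · rw [show Int.negSucc (n + 1) + 1 = Int.negSucc n from rfl, encode_negSucc, encode_negSucc,
      if_neg (by omega), if_neg (by omega)]
    omega

theorem primrec_int_sub_one : Primrec fun z : ℤ => z - 1 := by
  have onCodes : Primrec fun e : ℕ => if e = 0 then 1 else if e % 2 = 0 then e - 2 else e + 2 :=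
    Primrec.ite (Primrec.eq.comp .id (.const 0)) (.const 1)
      (Primrec.ite (Primrec.eq.comp (Primrec.nat_mod.comp .id (.const 2)) (.const 0))
        (Primrec.nat_sub.comp .id (.const 2)) (Primrec.nat_add.comp .id (.const 2)))
  refine Primrec.encode_iff.1 ((onCodes.comp Primrec.encode).of_eq fun z => ?_)
  rcases z with (_ | n) | n
  · rfl
  · rw [Int.ofNat_eq_natCast, Nat.cast_add_one, add_sub_cancel_right, ← Nat.cast_add_one,
      encode_natCast, encode_natCast, if_neg (by omega), if_pos (by omega)]
    omega
  · rw [show Int.negSucc n - 1 = Int.negSucc (n + 1) from rfl, encode_negSucc, encode_negSucc,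
      if_neg (by omega), if_neg (by omega)]
    omega

theorem primrec_update {n : ℕ} {α σ : Type*} [Primcodable α] [Primcodable σ]
    {f : α → Fin n → σ} {g : α → σ} (hf : Primrec f) (hg : Primrec g) (i : Fin n) :
    Primrec fun a => Function.update (f a) i (g a) := by
  refine primrec_pi fun j => ?_
  by_cases h : j = i
  · subst h
    simpa only [Function.update_self] using hg
  · simpa only [Function.update_of_ne h] using primrec_apply hf j

/-- The content of the cell `k` according to the list of all write operations, the most recent
first, if the cells are initialized with `b`. -/
def readLog {κ σ : Type*} [DecidableEq κ] (b : σ) (log : List (κ × σ)) (k : κ) : σ :=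
  (log.lookup k).getD b

theorem readLog_cons {κ σ : Type*} [DecidableEq κ] (b x : σ) (log : List (κ × σ)) (k k' : κ) :
    readLog b ((k', x) :: log) k = if k = k' then x else readLog b log k := by
  by_cases h : k = k'
  · simp [readLog, h]
  · simp [readLog, List.lookup_cons, beq_eq_false_iff_ne.2 h, h]

theorem readLog_ofFn {κ σ : Type*} [DecidableEq κ] (b : σ) {k : ℕ} {key : Fin k → κ}
    (hkey : Function.Injective key) (val : Fin k → σ) (j : Fin k) :
    readLog b (List.ofFn fun j => (key j, val j)) (key j) = val j := by
  induction k with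
  | zero => exact j.elim0
  | succ k ih =>
    rw [List.ofFn_succ, readLog_cons]
    cases j using Fin.cases with
    | zero => exact if_pos rfl
    | succ j =>
      rw [if_neg (hkey.ne (Fin.succ_ne_zero j))]
      exact ih (hkey.comp (Fin.succ_injective k)) (fun j => val j.succ) j

theorem readLog_of_forall_ne {κ σ : Type*} [DecidableEq κ] (b : σ) {log : List (κ × σ)} {k : κ}
    (h : ∀ e ∈ log, k ≠ e.1) : readLog b log k = b := by
  induction log with
  | nil => rfl
  | cons e log ih =>
    rw [readLog_cons, if_neg (h e List.mem_cons_self), ih fun e he => h e (.tail _ he)]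

namespace GTM

variable {A : Type} {F : GTMFrame}

/-- Approximations of configurations on infinite sequences: label, head positions, and the list of
all write operations, the most recent first, where finite words replace the infinite sequences.
They are tuples since this makes them primitively codable. -/
abbrev LogConf (A : Type) (F : GTMFrame) : Type :=
  F.Label × (Fin (F.L + 1) → ℤ) × List ((Fin (F.L + 1) × ℤ) × (List A ⊕ F.Γ))

namespace LogConf

/-- The label. -/
abbrev label (d : LogConf A F) : F.Label := d.1

/-- The head positions. -/
abbrev head (d : LogConf A F) : Fin (F.L + 1) → ℤ := d.2.1

/-- The list of all write operations. -/
abbrev log (d : LogConf A F) : List ((Fin (F.L + 1) × ℤ) × (List A ⊕ F.Γ)) := d.2.2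

/-- The content of cell `m` of tape `i`. -/
def read (d : LogConf A F) (i : Fin (F.L + 1)) (m : ℤ) : List A ⊕ F.Γ :=
  readLog (Sum.inr F.blank) d.log (i, m)

/-- The content of the scanned cell. -/
def scan (d : LogConf A F) (i : Fin (F.L + 1)) : List A ⊕ F.Γ := d.read i (d.head i)

/-- Change the label. -/
def goto (d : LogConf A F) (l : F.Label) : LogConf A F := (l, d.head, d.log)

/-- Move the head on tape `i` to position `m`. -/
def setHead (d : LogConf A F) (i : Fin (F.L + 1)) (m : ℤ) : LogConf A F :=
  (d.label, Function.update d.head i m, d.log)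

/-- Write `x` under the head of tape `i`. -/
def setCell (d : LogConf A F) (i : Fin (F.L + 1)) (x : List A ⊕ F.Γ) : LogConf A F :=
  (d.label, d.head, ((i, d.head i), x) :: d.log)

/-- The configuration with words on its tapes that is described by the log. -/
def toConf (d : LogConf A F) : Conf F fun _ => List A where
  label := d.label
  tape := d.read
  head := d.head

theorem toConf_setCell (d : LogConf A F) (i : Fin (F.L + 1)) (x : List A ⊕ F.Γ) :
    (d.setCell i x).toConf = d.toConf.setCell i x := by
  refine Conf.ext rfl (funext₂ fun j m => ?_) rfl
  simp only [toConf, read, setCell, log, readLog_cons, Prod.mk.injEq, Conf.setCell]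
  by_cases hj : j = i
  · subst hj
    simp only [true_and, Function.update_self, Function.update_apply]
    rfl
  · simp only [hj, false_and, if_false, Function.update_of_ne hj]
    rfl

/-- The words scanned on the tapes `t j`, provided that each of these tapes scans a word. -/
def words {n : ℕ} (d : LogConf A F) (t : Fin n → Fin (F.L + 1)) : Option (Fin n → List A) :=
  if ∀ j, (d.scan (t j)).isLeft then some fun j => (d.scan (t j)).elim id fun _ => [] else none

end LogConf

/-- The approximation of configurations: labels, heads and symbols are correct, and each infinite
sequence on a tape is approximated by a prefix. -/
def confApprox (A : Type) (F : GTMFrame) : ApproxRel (LogConf A F) (Conf F fun _ => ℕ → A) where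
  rel K d c := ConfRel (fun _ w => {q | (ApproxRel.prefixes A).rel K w q}) d.toConf c
  mono hK h := h.mono fun _ _ _ hq => (ApproxRel.prefixes A).mono hK hq

theorem confApprox_setCell {K : ℕ} {d : LogConf A F} {c : Conf F fun _ => ℕ → A}
    (h : (confApprox A F).rel K d c) (i : Fin (F.L + 1)) {x : List A ⊕ F.Γ} {y : (ℕ → A) ⊕ F.Γ}
    (hxy : CellRel (fun w => {q | (ApproxRel.prefixes A).rel K w q}) x y) :
    (confApprox A F).rel K (d.setCell i x) (c.setCell i y) := by
  change ConfRel _ (d.setCell i x).toConf _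
  rw [LogConf.toConf_setCell]
  exact h.setCell i hxy

theorem exists_words {K : ℕ} {d : LogConf A F} {c : Conf F fun _ => ℕ → A}
    (h : (confApprox A F).rel K d c) {n : ℕ} {t : Fin n → Fin (F.L + 1)} {x : Fin n → ℕ → A}
    (hx : ∀ j, c.scan (t j) = Sum.inl (x j)) :
    ∃ ws ∈ d.words t, (ApproxRel.tuples A (Fin n)).rel K ws x := by
  obtain ⟨ws, hws, hrel⟩ := h.exists_scan_eq_inl hx
  have scan_eq (j : Fin n) : d.scan (t j) = Sum.inl (ws j) := hws j
  exact ⟨ws, by simp [LogConf.words, scan_eq], hrel⟩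

theorem tracks_words {D C : Type*} {R : ApproxRel D C} {n : ℕ} {t : Fin n → Fin (F.L + 1)}
    {Φ : ℕ → (Fin n → List A) → Option D} {x : Fin n → ℕ → A} {y : C}
    (hΦ : Tracks (.tuples A (Fin n)) R Φ x y) {c : Conf F fun _ => ℕ → A}
    (hx : ∀ j, c.scan (t j) = Sum.inl (x j)) :
    Tracks (confApprox A F) R (fun N d => (d.words t).bind (Φ N)) c y :=
  (Tracks.of_forall fun _ _ hd => exists_words hd hx).comp hΦ

section Primrec

variable [Primcodable A] [Primcodable F.Label] [Primcodable F.Γ]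
  {α : Type*} [Primcodable α] {d : α → LogConf A F}

theorem primrec_label (hd : Primrec d) : Primrec fun a => (d a).label := Primrec.fst.comp hd

theorem primrec_head (hd : Primrec d) : Primrec fun a => (d a).head :=
  Primrec.fst.comp (Primrec.snd.comp hd)

theorem primrec_log (hd : Primrec d) : Primrec fun a => (d a).log :=
  Primrec.snd.comp (Primrec.snd.comp hd)

theorem primrec_readLog {κ σ : Type*} [Primcodable κ] [DecidableEq κ] [Primcodable σ] (b : σ) :
    Primrec₂ (readLog (κ := κ) b) :=
  Primrec.option_getD.comp (Primrec.listLookup.comp .snd .fst) (.const b)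

theorem primrec_read (hd : Primrec d) (i : Fin (F.L + 1)) (m : ℤ) :
    Primrec fun a => (d a).read i m :=
  (primrec_readLog _).comp (primrec_log hd) (.const (i, m))

theorem primrec_scan (hd : Primrec d) (i : Fin (F.L + 1)) : Primrec fun a => (d a).scan i :=
  (primrec_readLog _).comp (primrec_log hd) (.pair (.const i) (primrec_apply (primrec_head hd) i))

theorem primrec_goto {l : α → F.Label} (hd : Primrec d) (hl : Primrec l) :
    Primrec fun a => (d a).goto (l a) :=
  .pair hl (Primrec.snd.comp hd)

theorem primrec_setHead {m : α → ℤ} (hd : Primrec d) (i : Fin (F.L + 1)) (hm : Primrec m) :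
    Primrec fun a => (d a).setHead i (m a) :=
  .pair (primrec_label hd) (.pair (primrec_update (primrec_head hd) hm i) (primrec_log hd))

theorem primrec_setCell {x : α → List A ⊕ F.Γ} (hd : Primrec d) (i : Fin (F.L + 1))
    (hx : Primrec x) : Primrec fun a => (d a).setCell i (x a) :=
  .pair (primrec_label hd) (.pair (primrec_head hd) (Primrec.list_cons.comp
    (.pair (.pair (.const i) (primrec_apply (primrec_head hd) i)) hx) (primrec_log hd)))

theorem primrec_isLeft {β γ : Type*} [Primcodable β] [Primcodable γ] :
    Primrec (Sum.isLeft : β ⊕ γ → Bool) :=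
  (Primrec.sumCasesOn .id (.const true) (.const false)).of_eq fun x => by cases x <;> rfl

theorem primrec_words (hd : Primrec d) {n : ℕ} (t : Fin n → Fin (F.L + 1)) :
    Primrec fun a => (d a).words t := by
  classical
  have allLeft : Primrec fun a => decide (∀ j, ((d a).scan (t j)).isLeft) :=
    (Primrec.dom_finite fun b : Fin n → Bool => decide (∀ j, b j)).comp
      (primrec_pi fun j => primrec_isLeft.comp (primrec_scan hd (t j)))
  have left_getD : Primrec fun a => fun j => ((d a).scan (t j)).elim id fun _ => [] :=
    primrec_pi fun j => (Primrec.sumCasesOn (primrec_scan hd (t j)) .right (.const [])).of_eq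
      fun a => by cases (d a).scan (t j) <;> rfl
  exact Primrec.ite allLeft.primrecPred (Primrec.option_some.comp left_getD) (.const none)

theorem primrec_bind_words {n : ℕ} (t : Fin n → Fin (F.L + 1))
    {Φ : ℕ → (Fin n → List A) → Option (List A)} (hΦ : Primrec₂ Φ) :
    Primrec₂ fun N (d : LogConf A F) => (d.words t).bind (Φ N) :=
  Primrec.option_bind (primrec_words .snd t) (hΦ.comp (Primrec.fst.comp .fst) .snd)

end Primrec

end GTM

theorem wordOne_ne_wordZero (A : Type) [Alphabet A] : wordOne A ≠ wordZero A := fun h =>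
  Alphabet.zero_ne_one (List.head_eq_of_cons_eq h).symm

/-- The function in the statement, if any, is a computable function on infinite sequences. -/
def Stmt.IsComputable {A : Type} [Alphabet A] {F : GTMFrame} : (Stmt A F fun _ => ℕ → A) → Prop
  | .assign _ _ f _ => IsComputableSeqFun f
  | .test _ f _ _ _ _ => IsComputableWordFun f
  | _ => True

namespace GTM

variable {A : Type} {F : GTMFrame} [Alphabet A] [Primcodable A] [Primcodable F.Label]
  [Primcodable F.Γ]

/-- The effect of the statement can be computed on approximations by a primitive recursive
function, given sufficient resources. -/
def IsTrackable (s : Stmt A F fun _ => ℕ → A) : Prop :=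
  ∃ E : ℕ → LogConf A F → Option (LogConf A F), Primrec₂ E ∧
    ∀ c c', Exec s c c' → Tracks (confApprox A F) (confApprox A F) E c c'

theorem isTrackable_right (i : Fin (F.L + 1)) (l : F.Label) :
    IsTrackable (A := A) (.right i l) := by
  refine ⟨fun _ d => some ((d.setHead i (d.head i + 1)).goto l), ?_, ?_⟩
  · exact Primrec.option_some.comp (primrec_goto (primrec_setHead .snd i
      (primrec_int_add_one.comp (primrec_apply (primrec_head .snd) i))) (.const l))
  · rintro c _ rfl
    exact .of_map fun K d hd => hd.2.1 ▸ (hd.setHead i _).goto l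

theorem isTrackable_left (i : Fin (F.L + 1)) (l : F.Label) :
    IsTrackable (A := A) (.left i l) := by
  refine ⟨fun _ d => some ((d.setHead i (d.head i - 1)).goto l), ?_, ?_⟩
  · exact Primrec.option_some.comp (primrec_goto (primrec_setHead .snd i
      (primrec_int_sub_one.comp (primrec_apply (primrec_head .snd) i))) (.const l))
  · rintro c _ rfl
    exact .of_map fun K d hd => hd.2.1 ▸ (hd.setHead i _).goto l

theorem isTrackable_write (i : Fin (F.L + 1)) (a : F.Γ) (l : F.Label) :
    IsTrackable (A := A) (.write i a l) := by
  refine ⟨fun _ d => some ((d.setCell i (Sum.inr a)).goto l), ?_, ?_⟩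
  · exact Primrec.option_some.comp (primrec_goto (primrec_setCell .snd i (.const _)) (.const l))
  · rintro c _ rfl
    exact .of_map fun K d hd => (confApprox_setCell hd i (.inr rfl)).goto l

theorem isTrackable_ifSym (i : Fin (F.L + 1)) (a : F.Γ) (l l' : F.Label) :
    IsTrackable (A := A) (.ifSym i a l l') := by
  classical
  refine ⟨fun _ d => some (d.goto (if d.scan i = Sum.inr a then l else l')), ?_, ?_⟩
  · exact Primrec.option_some.comp (primrec_goto .snd (Primrec.ite
      (Primrec.eq.comp (primrec_scan .snd i) (.const _)) (.const l) (.const l')))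
  · rintro c _ (⟨h, rfl⟩ | ⟨h, rfl⟩)
    · refine .of_map fun K d hd => ?_
      have scan_eq : d.scan i = Sum.inr a := (hd.scan_eq_inr_iff i a).2 h
      rw [if_pos scan_eq]
      exact hd.goto l
    · refine .of_map fun K d hd => ?_
      have scan_ne : d.scan i ≠ Sum.inr a := mt (hd.scan_eq_inr_iff i a).1 h
      rw [if_neg scan_ne]
      exact hd.goto l'

theorem isTrackable_assign (i : Fin (F.L + 1)) {n : ℕ} (t : Fin n → Fin (F.L + 1))
    {f : MultiFun (Fin n → ℕ → A) (ℕ → A)} (hf : IsComputableSeqFun f) (l : F.Label) :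
    IsTrackable (A := A) (F := F) (.assign i t f l) := by
  have : Finite A := Alphabet.finite
  obtain ⟨M, hM⟩ := hf.2
  obtain ⟨Φ, hΦ, tracks⟩ := M.exists_primrec_tracks_seqFun
  refine ⟨fun N d => ((d.words t).bind (Φ N)).map fun w => (d.setCell i (Sum.inl w)).goto l,
    Primrec.option_map (primrec_bind_words t hΦ) (primrec_goto (primrec_setCell
      (Primrec.snd.comp .fst) i (Primrec.sumInl.comp .snd)) (.const l)), ?_⟩
  rintro c _ ⟨x, hx, q, hq, rfl⟩
  exact (tracks_words (tracks x q (hM x q hq)) hx).map₂ fun K d w hd hw =>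
    (confApprox_setCell hd i (.inl hw)).goto l

theorem isTrackable_test {n : ℕ} (t : Fin n → Fin (F.L + 1))
    {f : MultiFun (Fin n → ℕ → A) (List A)} (partialFun : f.IsPartialFun)
    (range : ∀ x, f x ⊆ {wordZero A, wordOne A}) (hf : IsComputableWordFun f) (l l' : F.Label) :
    IsTrackable (A := A) (F := F) (.test t f partialFun range l l') := by
  classical
  have : Finite A := Alphabet.finite
  obtain ⟨M, hM⟩ := hf.2
  obtain ⟨Ψ, hΨ, tracks⟩ := M.exists_primrec_tracks_wordFun
  refine ⟨fun N d => ((d.words t).bind (Ψ N)).map fun w =>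
      d.goto (if w = wordZero A then l else l'),
    Primrec.option_map (primrec_bind_words t hΨ) (primrec_goto (Primrec.snd.comp .fst)
      (Primrec.ite (Primrec.eq.comp .snd (.const _)) (.const l) (.const l'))), ?_⟩
  rintro c c' ⟨x, hx, h⟩
  have tracks_goto (w) (hw : w ∈ f x) :=
    (tracks_words (tracks x w (hM x w hw)) hx).map₂ (R'' := confApprox A F)
      (g := fun d w => d.goto (if w = wordZero A then l else l'))
      (c'' := c.goto (if w = wordZero A then l else l'))
      fun K d w' hd hw' => hw' ▸ hd.goto _
  rcases h with ⟨hw, rfl⟩ | ⟨hw, rfl⟩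
  · simpa only [if_true] using tracks_goto _ hw
  · simpa only [wordOne_ne_wordZero, if_false] using tracks_goto _ hw

theorem _root_.Stmt.IsComputable.isTrackable {s : Stmt A F fun _ => ℕ → A}
    (hs : s.IsComputable) : IsTrackable s :=
  match s, hs with
  | .right i l, _ => isTrackable_right i l
  | .left i l, _ => isTrackable_left i l
  | .write i a l, _ => isTrackable_write i a l
  | .ifSym i a l l', _ => isTrackable_ifSym i a l l'
  | .assign i t _ l, hf => isTrackable_assign i t hf l
  | .test t _ partialFun range l l', hf => isTrackable_test t partialFun range hf l l'

end GTM

/-! ## Deterministic generalized Turing machines -/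

/-- Statements that lead to at most one successor configuration: the function in an assignment has
at most one value. -/
def Stmt.IsDeterministic {A : Type} [Alphabet A] {F : GTMFrame} {X : Fin (F.L + 1) → Type u} :
    Stmt A F X → Prop
  | .assign _ _ f _ => f.IsPartialFun
  | _ => True

theorem Stmt.IsComputable.isDeterministic {A : Type} [Alphabet A] {F : GTMFrame}
    {s : Stmt A F fun _ => ℕ → A} (hs : s.IsComputable) : s.IsDeterministic :=
  match s, hs with
  | .assign _ _ _ _, hf => hf.1
  | .right _ _, _ | .left _ _, _ | .write _ _ _, _ | .ifSym _ _ _ _, _ | .test _ _ _ _ _ _, _ =>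
    trivial

namespace GTM

variable {A : Type} [Alphabet A] {F : GTMFrame} {X : Fin (F.L + 1) → Type u} {M : GTM A F X}

theorem _root_.Stmt.IsDeterministic.rightUnique_exec {s : Stmt A F X} (hs : s.IsDeterministic) :
    Relator.RightUnique (Exec s) := by
  intro c c' c'' h' h''
  cases s with
  | right i l => exact h'.trans h''.symm
  | left i l => exact h'.trans h''.symm
  | write i a l => exact h'.trans h''.symm
  | ifSym i a l l' =>
    rcases h' with ⟨h', rfl⟩ | ⟨h', rfl⟩ <;> rcases h'' with ⟨h'', rfl⟩ | ⟨h'', rfl⟩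
    exacts [rfl, absurd h' h'', absurd h'' h', rfl]
  | assign i t f l =>
    obtain ⟨x, hx, y, hy, rfl⟩ := h'
    obtain ⟨x', hx', y', hy', rfl⟩ := h''
    obtain rfl := eq_of_scan_eq_inl hx hx'
    rw [hs x hy hy']
  | test t f partialFun _ l l' =>
    obtain ⟨x, hx, h'⟩ := h'
    obtain ⟨x', hx', h''⟩ := h''
    obtain rfl := eq_of_scan_eq_inl hx hx'
    rcases h' with ⟨h', rfl⟩ | ⟨h', rfl⟩ <;> rcases h'' with ⟨h'', rfl⟩ | ⟨h'', rfl⟩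
    exacts [rfl, absurd (partialFun x h'' h') (wordOne_ne_wordZero A),
      absurd (partialFun x h' h'') (wordOne_ne_wordZero A), rfl]

theorem rightUnique_step (hM : ∀ l, (M.stm l).IsDeterministic) : Relator.RightUnique M.Step :=
  fun _ _ _ ⟨_, h'⟩ ⟨_, h''⟩ => (hM _).rightUnique_exec h' h''

theorem not_step_of_final {c c' : Conf F X} (h : c.label = F.final) : ¬ M.Step c c' :=
  fun ⟨h', _⟩ => h' h

theorem eq_of_reaches_final {c c' : Conf F X} (h : c.label = F.final)
    (hr : Relation.ReflTransGen M.Step c c') : c = c' :=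
  hr.cases_head.resolve_right fun ⟨_, hd, _⟩ => not_step_of_final h hd

theorem isPartialFun_computes (hM : ∀ l, (M.stm l).IsDeterministic) :
    M.computes.IsPartialFun := by
  rintro x y ⟨-, c, hc, hl, hy⟩ y' ⟨-, c', hc', hl', hy'⟩
  obtain rfl : c = c' := by
    rcases Relation.ReflTransGen.total_of_right_unique (rightUnique_step hM) hc hc' with h | h
    · exact eq_of_reaches_final hl h
    · exact (eq_of_reaches_final hl' h).symm
  exact Sum.inl_injective (hy.symm.trans hy')

end GTM

/-! ## Running a generalized Turing machine on approximations -/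

/-- The rows of a word of columns. -/
def rows {A : Type*} {n : ℕ} (u : List (Fin n → A)) : Fin n → List A := fun j => u.map (· j)

theorem tuples_rel_rows_columns {A : Type*} {n : ℕ} (p : Fin n → ℕ → A) (N : ℕ) :
    (ApproxRel.tuples A (Fin n)).rel N (rows (columns p N)) p := fun j =>
  ⟨SeqPrefix.iff_eq_map_range.2 (by simp [rows, columns]), by simp [rows, columns]⟩

theorem exists_type2Machine_of_tracks {A : Type} [Finite A] [Nonempty A] [Primcodable A] {n : ℕ}
    {Φ : ℕ → (Fin n → List A) → Option (List A)} (hΦ : Primrec₂ Φ) :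
    ∃ M : Type2Machine A n, ∀ p q, Tracks (.tuples A (Fin n)) (.prefixes A) Φ p q →
      q ∈ M.seqFun p := by
  have primrec_rows : Primrec (rows (A := A) (n := n)) :=
    primrec_pi fun j => Primrec.list_map .id (primrec_apply .snd j)
  have primrec_getD : Primrec fun u : List (Fin n → A) => (Φ u.length (rows u)).getD [] :=
    Primrec.option_getD.comp (hΦ.comp .list_length primrec_rows) (.const [])
  obtain ⟨M, hM⟩ := exists_type2Machine_of_primrec primrec_getD
  have length_columns (p : Fin n → ℕ → A) (N : ℕ) : (columns p N).length = N := by simp [columns]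
  refine ⟨M, fun p q h => hM p q (fun N => ?_) fun K => ?_⟩
  · cases hw : Φ (columns p N).length (rows (columns p N)) with
    | none => exact .nil q
    | some w =>
      exact (h.sound (ApproxRel.mono _ N.zero_le (tuples_rel_rows_columns p N)) hw).1
  · obtain ⟨T, hT⟩ := h.exists_level K
    refine ⟨T, fun N hN => ?_⟩
    obtain ⟨w, hw, hrel⟩ := hT N hN _ (ApproxRel.mono _ hN (tuples_rel_rows_columns p N))
    rw [length_columns, Option.mem_def.1 hw]
    exact hrel.2

namespace GTM

variable {A : Type} {F : GTMFrame}

/-- The approximation of the initial configuration given by approximations of the inputs. -/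
def initLog (ws : Fin F.k → List A) : LogConf A F :=
  (F.start, fun _ => 0, List.ofFn fun j => ((F.inTape j, 0), Sum.inl (ws j)))

theorem read_initLog_inTape (ws : Fin F.k → List A) (j : Fin F.k) :
    (initLog ws).read (F.inTape j) 0 = Sum.inl (ws j) := by
  refine readLog_ofFn _ (key := fun j => (F.inTape j, (0 : ℤ))) (fun i j h => ?_) _ j
  simpa [GTMFrame.inTape] using h

theorem read_initLog_of_forall_ne (ws : Fin F.k → List A) {i : Fin (F.L + 1)} {m : ℤ}
    (h : ∀ j, m = 0 → i ≠ F.inTape j) : (initLog ws).read i m = Sum.inr F.blank := by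
  refine readLog_of_forall_ne _ fun e he => ?_
  obtain ⟨j, rfl⟩ := List.mem_ofFn.1 he
  exact fun hkey => h j (Prod.mk.inj hkey).2 (Prod.mk.inj hkey).1

theorem toConf_initLog (ws : Fin F.k → List A) :
    (initLog ws).toConf = initConf (X := fun _ => List A) ws := by
  refine Conf.ext rfl (funext₂ fun i m => ?_) rfl
  by_cases h : ∃ j, m = 0 ∧ i = F.inTape j
  · obtain ⟨j, rfl, rfl⟩ := h
    exact (read_initLog_inTape ws j).trans (initConf_tape_inTape (X := fun _ => List A) ws j).symm
  · have hne (j) (hm : m = 0) (hi : i = F.inTape j) : False := h ⟨j, hm, hi⟩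
    exact (read_initLog_of_forall_ne ws hne).trans
      (initConf_tape_of_forall_ne (X := fun _ => List A) ws hne).symm

theorem confApprox_initLog {K : ℕ} {ws : Fin F.k → List A} {x : Fin F.k → ℕ → A}
    (hws : (ApproxRel.tuples A (Fin F.k)).rel K ws x) :
    (confApprox A F).rel K (initLog ws) (initConf x) := by
  change ConfRel _ (initLog ws).toConf _
  rw [toConf_initLog]
  exact ConfRel.initConf hws

/-- The word in cell `0` of the output tape, provided that the label is final. -/
noncomputable def LogConf.output (d : LogConf A F) : Option (List A) :=
  open scoped Classical in if d.label = F.final then (d.read 0 0).getLeft? else none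

theorem mem_output_iff {d : LogConf A F} {w : List A} :
    w ∈ d.output ↔ AcceptsWith d.toConf w :=
  Option.ite_none_right_eq_some.trans (and_congr_right' Sum.getLeft?_eq_some_iff)

/-- One step on approximations, where `E l` describes the effect of the statement at the label
`l`. Final configurations are not changed. -/
noncomputable def logStep (E : {l // l ≠ F.final} → ℕ → LogConf A F → Option (LogConf A F))
    (N : ℕ) (d : LogConf A F) : Option (LogConf A F) :=
  open scoped Classical in if h : d.label ≠ F.final then E ⟨d.label, h⟩ N d else some d

/-- The result of `t` steps on approximations, if they can be executed with the resources `N`. -/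
noncomputable def logRun (E : {l // l ≠ F.final} → ℕ → LogConf A F → Option (LogConf A F))
    (t N : ℕ) (ws : Fin F.k → List A) : Option (LogConf A F) :=
  (fun d => d.bind (logStep E N))^[t] (some (initLog ws))

/-- The output after `N` steps with the resources `N`. -/
noncomputable def logOutput (E : {l // l ≠ F.final} → ℕ → LogConf A F → Option (LogConf A F))
    (N : ℕ) (ws : Fin F.k → List A) : Option (List A) :=
  (logRun E N N ws).bind LogConf.output

variable {E : {l // l ≠ F.final} → ℕ → LogConf A F → Option (LogConf A F)}

theorem logStep_of_final {N : ℕ} {d : LogConf A F} (h : d.label = F.final) :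
    logStep E N d = some d :=
  dif_neg (not_not.2 h)

theorem logRun_succ (t : ℕ) :
    logRun E (t + 1) = fun N ws => (logRun E t N ws).bind (logStep E N) :=
  funext₂ fun _ _ => Function.iterate_succ_apply' _ _ _

theorem mem_logRun_of_le {t t' N : ℕ} (htt' : t ≤ t') {ws : Fin F.k → List A} {d : LogConf A F}
    (hd : d ∈ logRun E t N ws) (h : d.label = F.final) : d ∈ logRun E t' N ws := by
  induction t', htt' using Nat.le_induction with
  | base => exact hd
  | succ t' _ ih =>
    rw [logRun_succ]
    exact Option.bind_eq_some_iff.2 ⟨d, ih, logStep_of_final h⟩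

section Tracks

variable [Alphabet A] {M : GTM A F fun _ => ℕ → A}
  (hE : ∀ l c c', Exec (M.stm l) c c' → Tracks (confApprox A F) (confApprox A F) (E l) c c')
include hE

theorem tracks_logStep {c c' : Conf F fun _ => ℕ → A} (h : M.Step c c') :
    Tracks (confApprox A F) (confApprox A F) (logStep E) c c' := by
  obtain ⟨hl, hex⟩ := h
  refine (hE _ _ _ hex).congr fun N d hd => ?_
  obtain ⟨l, rest⟩ := d
  obtain rfl : l = c.label := hd.1
  exact dif_pos hl

theorem exists_tracks_logRun {p : Fin F.k → ℕ → A} {c : Conf F fun _ => ℕ → A}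
    (hc : Relation.ReflTransGen M.Step (initConf p) c) :
    ∃ t, Tracks (.tuples A (Fin F.k)) (confApprox A F) (logRun E t) p c := by
  induction hc with
  | refl => exact ⟨0, .of_map fun _ _ => confApprox_initLog⟩
  | tail _ hstep ih =>
    obtain ⟨t, ht⟩ := ih
    refine ⟨t + 1, ?_⟩
    rw [logRun_succ]
    exact ht.comp (tracks_logStep hE hstep)

theorem exists_reaches_tracks_logRun {p : Fin F.k → ℕ → A} {c : Conf F fun _ => ℕ → A}
    (hc : Relation.ReflTransGen M.Step (initConf p) c) (hl : c.label = F.final) (t : ℕ) :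
    ∃ c', Relation.ReflTransGen M.Step c' c ∧
      Tracks (.tuples A (Fin F.k)) (confApprox A F) (logRun E t) p c' := by
  induction t with
  | zero => exact ⟨_, hc, .of_map fun _ _ => confApprox_initLog⟩
  | succ t ih =>
    rw [logRun_succ]
    obtain ⟨c', hc', htracks⟩ := ih
    rcases hc'.cases_head with rfl | ⟨c'', hstep, hc''⟩
    · refine ⟨c', .refl, htracks.comp ?_⟩
      have tracks_some : Tracks (confApprox A F) (confApprox A F) (fun _ => some) c' c' :=
        .of_map fun _ _ hd => hd
      exact tracks_some.congr fun N d hd => logStep_of_final (hd.1.trans hl)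
    · exact ⟨c'', hc'', htracks.comp (tracks_logStep hE hstep)⟩

theorem tracks_logOutput {p : Fin F.k → ℕ → A} {q : ℕ → A} (hq : q ∈ M.computes p) :
    Tracks (.tuples A (Fin F.k)) (.prefixes A) (logOutput E) p q := by
  obtain ⟨-, c, hc, hacc⟩ := hq
  refine ⟨fun {N ws w} hws hw => ?_, fun K => ?_⟩
  · obtain ⟨d, hd, hw⟩ := Option.bind_eq_some_iff.1 hw
    obtain ⟨c', hc', htracks⟩ := exists_reaches_tracks_logRun hE hc hacc.1 N
    obtain ⟨q', hacc', hrel⟩ :=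
      ConfRel.exists_acceptsWith_right (htracks.sound hws hd) (mem_output_iff.1 hw)
    obtain rfl := eq_of_reaches_final hacc'.1 hc'
    rwa [Sum.inl_injective (hacc.2.symm.trans hacc'.2)]
  · obtain ⟨t, htracks⟩ := exists_tracks_logRun hE hc
    obtain ⟨T, hT⟩ := htracks.exists_level K
    refine ⟨max T t, fun N hN ws hws => ?_⟩
    obtain ⟨d, hd, hrel⟩ :=
      hT N (le_of_max_le_left hN) ws (ApproxRel.mono _ (le_max_left _ _) hws)
    obtain ⟨w, hw, hwq⟩ := ConfRel.exists_acceptsWith_left hrel hacc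
    exact ⟨w, Option.bind_eq_some_iff.2
      ⟨d, mem_logRun_of_le (le_of_max_le_right hN) hd (hrel.1.trans hacc.1),
        mem_output_iff.2 hw⟩, hwq⟩

end Tracks

section Primrec

variable [Primcodable A] [Primcodable F.Label] [Primcodable F.Γ]

theorem primrec_output : Primrec (LogConf.output (A := A) (F := F)) := by
  classical
  have primrec_getLeft? : Primrec (Sum.getLeft? : List A ⊕ F.Γ → Option (List A)) :=
    (Primrec.sumCasesOn .id (Primrec.option_some.comp₂ .right) (.const none)).of_eq
      fun x => by cases x <;> rfl
  exact Primrec.ite (Primrec.eq.comp (primrec_label .id) (.const _))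
    (primrec_getLeft?.comp (primrec_read .id 0 0)) (.const none)

theorem primrec_initLog : Primrec (initLog (A := A) (F := F)) :=
  .pair (.const _) (.pair (.const _) (Primrec.list_ofFn fun j =>
    .pair (.const _) (Primrec.sumInl.comp (primrec_apply .id j))))

theorem primrec_logStep (hE : ∀ l, Primrec₂ (E l)) : Primrec₂ (logStep E) := by
  have := F.labelFinite
  classical
  have primrec_cases : Primrec₂ fun l (x : ℕ × LogConf A F) =>
      if h : l ≠ F.final then E ⟨l, h⟩ x.1 x.2 else some x.2 := by
    refine primrec₂_of_finite fun l => ?_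
    by_cases h : l ≠ F.final
    · simp only [dif_pos h]
      exact hE ⟨l, h⟩
    · simp only [dif_neg h]
      exact Primrec.option_some.comp .snd
  exact primrec_cases.comp (primrec_label .snd) .id

theorem primrec_logOutput (hE : ∀ l, Primrec₂ (E l)) : Primrec₂ (logOutput E) := by
  have primrec_run : Primrec fun x : ℕ × (Fin F.k → List A) => logRun E x.1 x.1 x.2 :=
    Primrec.nat_iterate .fst (Primrec.option_some.comp (primrec_initLog.comp .snd))
      (Primrec.option_bind .snd
        ((primrec_logStep hE).comp (Primrec.fst.comp (Primrec.fst.comp .fst)) .snd))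
  exact Primrec.option_bind primrec_run (primrec_output.comp .snd)

end Primrec

theorem isComputableSeqFun_computes [Alphabet A] {M : GTM A F fun _ => ℕ → A}
    (hM : ∀ l, (M.stm l).IsComputable) : IsComputableSeqFun (n := F.k) M.computes := by
  have : Finite A := Alphabet.finite
  have : Nonempty A := ⟨Alphabet.zero⟩
  have := F.labelFinite
  have := F.symFinite
  let := finitePrimcodable A
  let := finitePrimcodable F.Label
  let := finitePrimcodable F.Γ
  choose E primrec_E hE using fun l => (hM l).isTrackable
  obtain ⟨T, hT⟩ := exists_type2Machine_of_tracks (primrec_logOutput primrec_E)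
  exact ⟨isPartialFun_computes fun l => (hM l).isDeterministic,
    T, fun p q hq => hT p q (tracks_logOutput hE hq)⟩

end GTM

/-! ## Realizing statements and machines -/

theorem Realizes.subset_of_idWord {A : Type} {n : ℕ} {X : Fin n → Type u} {Y : Fin n → Type v}
    {γ : ∀ j, MultiFun (X j) (Y j)} {f : MultiFun (∀ j, X j) (List A)}
    {g : MultiFun (∀ j, Y j) (List A)} (h : Realizes γ (idWord A) f g) {x : ∀ j, X j}
    {y : ∀ j, Y j} (hxy : ∀ j, y j ∈ γ j (x j)) (hy : (g y).Nonempty) : f x ⊆ g y := by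
  intro w hw
  obtain ⟨w', hw', rfl⟩ := (h x y hxy hy).2 w hw
  exact hw'

namespace GTM

variable {A : Type} [Alphabet A] {F : GTMFrame} {X : Fin (F.L + 1) → Type u}
  {Y : Fin (F.L + 1) → Type u} {Z : Fin (F.L + 1) → Type v} {δ : ∀ i, MultiFun (Y i) (Z i)}

/-- Whenever the statement `s'` can be executed, the statement `s` can be executed in each
corresponding configuration, and all its results correspond to results of `s'`. -/
def Simulates (δ : ∀ i, MultiFun (Y i) (Z i)) (s : Stmt A F Y) (s' : Stmt A F Z) : Prop :=
  ∀ c d, ConfRel δ c d → (∃ d', Exec s' d d') →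
    (∃ c', Exec s c c') ∧ ∀ c', Exec s c c' → ∃ d', Exec s' d d' ∧ ConfRel δ c' d'

theorem simulates_right (i : Fin (F.L + 1)) (l : F.Label) :
    Simulates δ (A := A) (.right i l) (.right i l) := by
  refine fun c d h _ => ⟨⟨_, rfl⟩, ?_⟩
  rintro _ rfl
  exact ⟨_, rfl, h.2.1 ▸ (h.setHead i _).goto l⟩

theorem simulates_left (i : Fin (F.L + 1)) (l : F.Label) :
    Simulates δ (A := A) (.left i l) (.left i l) := by
  refine fun c d h _ => ⟨⟨_, rfl⟩, ?_⟩
  rintro _ rfl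
  exact ⟨_, rfl, h.2.1 ▸ (h.setHead i _).goto l⟩

theorem simulates_write (i : Fin (F.L + 1)) (a : F.Γ) (l : F.Label) :
    Simulates δ (A := A) (.write i a l) (.write i a l) := by
  refine fun c d h _ => ⟨⟨_, rfl⟩, ?_⟩
  rintro _ rfl
  exact ⟨_, rfl, (h.setCell i (.inr rfl)).goto l⟩

theorem simulates_ifSym (i : Fin (F.L + 1)) (a : F.Γ) (l l' : F.Label) :
    Simulates δ (A := A) (.ifSym i a l l') (.ifSym i a l l') := by
  refine fun c d h _ => ⟨?_, ?_⟩
  · by_cases ha : c.scan i = Sum.inr a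
    exacts [⟨_, .inl ⟨ha, rfl⟩⟩, ⟨_, .inr ⟨ha, rfl⟩⟩]
  · rintro _ (⟨ha, rfl⟩ | ⟨ha, rfl⟩)
    · exact ⟨_, .inl ⟨(h.scan_eq_inr_iff i a).1 ha, rfl⟩, h.goto l⟩
    · exact ⟨_, .inr ⟨mt (h.scan_eq_inr_iff i a).2 ha, rfl⟩, h.goto l'⟩

theorem simulates_assign (i : Fin (F.L + 1)) {n : ℕ} {t : Fin n → Fin (F.L + 1)}
    {g : MultiFun (∀ j, Y (t j)) (Y i)} {f : MultiFun (∀ j, Z (t j)) (Z i)}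
    (hgf : Realizes (fun j => δ (t j)) (δ i) g f) (l : F.Label) :
    Simulates δ (A := A) (.assign i t g l) (.assign i t f l) := by
  rintro c d h ⟨_, z, hz, w, hw, -⟩
  obtain ⟨y, hy, hyz⟩ := h.exists_scan_eq_inl hz
  obtain ⟨⟨v, hv⟩, hall⟩ := hgf y z hyz ⟨w, hw⟩
  refine ⟨⟨_, y, hy, v, hv, rfl⟩, ?_⟩
  rintro _ ⟨y', hy', v', hv', rfl⟩
  obtain rfl := eq_of_scan_eq_inl hy hy'
  obtain ⟨w', hw', hvw⟩ := hall v' hv'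
  exact ⟨_, ⟨z, hz, w', hw', rfl⟩, (h.setCell i (.inl hvw)).goto l⟩

theorem simulates_test {n : ℕ} {t : Fin n → Fin (F.L + 1)}
    {g : MultiFun (∀ j, Y (t j)) (List A)} (hg : g.IsPartialFun)
    (hg' : ∀ x, g x ⊆ {wordZero A, wordOne A}) {f : MultiFun (∀ j, Z (t j)) (List A)}
    (hf : f.IsPartialFun) (hf' : ∀ x, f x ⊆ {wordZero A, wordOne A})
    (hgf : Realizes (fun j => δ (t j)) (idWord A) g f) (l l' : F.Label) :
    Simulates δ (.test t g hg hg' l l') (.test t f hf hf' l l') := by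
  rintro c d h ⟨_, z, hz, hfz⟩
  obtain ⟨y, hy, hyz⟩ := h.exists_scan_eq_inl hz
  have hne : (f z).Nonempty := hfz.elim (fun h => ⟨_, h.1⟩) fun h => ⟨_, h.1⟩
  have hsub : g y ⊆ f z := hgf.subset_of_idWord hyz hne
  obtain ⟨v, hv⟩ := (hgf y z hyz hne).1
  refine ⟨?_, ?_⟩
  · rcases hg' y hv with rfl | rfl
    exacts [⟨_, y, hy, .inl ⟨hv, rfl⟩⟩, ⟨_, y, hy, .inr ⟨hv, rfl⟩⟩]
  · rintro _ ⟨y', hy', hv'⟩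
    obtain rfl := eq_of_scan_eq_inl hy hy'
    rcases hv' with ⟨hv', rfl⟩ | ⟨hv', rfl⟩
    · exact ⟨_, ⟨z, hz, .inl ⟨hsub hv', rfl⟩⟩, h.goto l⟩
    · exact ⟨_, ⟨z, hz, .inr ⟨hsub hv', rfl⟩⟩, h.goto l'⟩

theorem _root_.StmtReplaces.simulates {γ : ∀ i, MultiFun (ℕ → A) (Y i)} {s : Stmt A F Y}
    {s' : Stmt A F Z} (h : StmtReplaces γ δ s s') : Simulates δ s s' :=
  match h with
  | .right i l => simulates_right i l
  | .left i l => simulates_left i l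
  | .write i a l => simulates_write i a l
  | .ifSym i a l l' => simulates_ifSym i a l l'
  | .assign i _ _ _ l hgf _ => simulates_assign i hgf l
  | .test _ _ hg hg' _ hf hf' l l' hgf _ => simulates_test hg hg' hf hf' hgf l l'

section AllMaximalAccepting

variable {M : GTM A F X} {c c' : Conf F X}

theorem allMaximalAccepting_iff_acc : M.AllMaximalAccepting c ↔
    Acc (fun c' c => M.Step c c') c ∧
      ∀ c', Relation.ReflTransGen M.Step c c' → (∀ c'', ¬ M.Step c' c'') → Accepting c' :=
  and_congr_left' (not_iff_comm.1 not_acc_iff_exists_descending_chain)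

theorem AllMaximalAccepting.of_step (h : M.AllMaximalAccepting c) (hs : M.Step c c') :
    M.AllMaximalAccepting c' := by
  rw [allMaximalAccepting_iff_acc] at h ⊢
  exact ⟨h.1.inv hs, fun c'' hc'' => h.2 c'' (.head hs hc'')⟩

theorem allMaximalAccepting_of_forall_step (hs : ∀ c', M.Step c c' → M.AllMaximalAccepting c')
    (hc : (∀ c', ¬ M.Step c c') → Accepting c) : M.AllMaximalAccepting c := by
  rw [allMaximalAccepting_iff_acc]
  refine ⟨.intro c fun c' h => (allMaximalAccepting_iff_acc.1 (hs c' h)).1, fun c' hr => ?_⟩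
  rcases hr.cases_head with rfl | ⟨c'', h, hr'⟩
  exacts [hc, (hs c'' h).2 c' hr']

theorem AllMaximalAccepting.induction {p : Conf F X → Prop} (h : M.AllMaximalAccepting c)
    (ih : ∀ c, M.AllMaximalAccepting c → (∀ c', M.Step c c' → p c') → p c) : p c := by
  induction (allMaximalAccepting_iff_acc.1 h).1 with
  | intro c _ hc => exact ih c h fun c' hs => hc c' hs (h.of_step hs)

theorem AllMaximalAccepting.exists_reaches_accepting (h : M.AllMaximalAccepting c) :
    ∃ c', Relation.ReflTransGen M.Step c c' ∧ Accepting c' := by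
  refine h.induction (p := fun c => ∃ c', Relation.ReflTransGen M.Step c c' ∧ Accepting c')
    fun c h ih => ?_
  by_cases hs : ∃ c', M.Step c c'
  · obtain ⟨c', hs⟩ := hs
    obtain ⟨c'', hr, hacc⟩ := ih c' hs
    exact ⟨c'', .head hs hr, hacc⟩
  · exact ⟨c, .refl, h.2 c .refl (not_exists.1 hs)⟩

end AllMaximalAccepting

section Machines

variable {M : GTM A F Y} {P : GTM A F Z} (hMP : ∀ l, Simulates δ (M.stm l) (P.stm l))
  {c c' : Conf F Y} {d : Conf F Z}
include hMP

theorem ConfRel.exists_step_and_forall_step (h : ConfRel δ c d) (hd : ∃ d', P.Step d d') :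
    (∃ c', M.Step c c') ∧ ∀ c', M.Step c c' → ∃ d', P.Step d d' ∧ ConfRel δ c' d' := by
  obtain ⟨d', hl, hex⟩ := hd
  obtain ⟨l, tape, head⟩ := c
  obtain rfl : l = d.label := h.1
  obtain ⟨⟨c', hc'⟩, hall⟩ := hMP ⟨d.label, hl⟩ _ d h ⟨d', hex⟩
  refine ⟨⟨c', hl, hc'⟩, fun c'' ⟨_, hc''⟩ => ?_⟩
  obtain ⟨d'', hd'', hrel⟩ := hall c'' hc''
  exact ⟨d'', ⟨hl, hd''⟩, hrel⟩

theorem ConfRel.exists_step (h : ConfRel δ c d) (hd : P.AllMaximalAccepting d)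
    (hs : M.Step c c') : ∃ d', P.Step d d' ∧ ConfRel δ c' d' := by
  refine (h.exists_step_and_forall_step hMP ?_).2 c' hs
  by_contra! hstuck
  obtain ⟨z, hz⟩ := hd.2 d .refl hstuck
  exact not_step_of_final (h.1.trans hz.1) hs

theorem ConfRel.allMaximalAccepting (h : ConfRel δ c d) (hd : P.AllMaximalAccepting d) :
    M.AllMaximalAccepting c := by
  refine hd.induction (p := fun d => ∀ c, ConfRel δ c d → M.AllMaximalAccepting c)
    (fun d hd ih c h => ?_) c h
  refine allMaximalAccepting_of_forall_step (fun c' hs => ?_) fun hstuck => ?_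
  · obtain ⟨d', hs', h'⟩ := h.exists_step hMP hd hs
    exact ih d' hs' c' h'
  · obtain ⟨z, hz⟩ := hd.2 d .refl fun d' hs =>
      (h.exists_step_and_forall_step hMP ⟨d', hs⟩).1.elim hstuck
    obtain ⟨y, hy, -⟩ := h.exists_acceptsWith_left hz
    exact ⟨y, hy⟩

theorem ConfRel.exists_reaches (h : ConfRel δ c d) (hd : P.AllMaximalAccepting d)
    (hr : Relation.ReflTransGen M.Step c c') :
    ∃ d', Relation.ReflTransGen P.Step d d' ∧ ConfRel δ c' d' := by
  induction hr using Relation.ReflTransGen.head_induction_on generalizing d with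
  | refl => exact ⟨d, .refl, h⟩
  | head hs _ ih =>
    obtain ⟨d', hs', h'⟩ := h.exists_step hMP hd hs
    obtain ⟨d'', hr', h''⟩ := ih h' (hd.of_step hs')
    exact ⟨d'', .head hs' hr', h''⟩

theorem realizes_computes :
    Realizes (fun j => δ (F.inTape j)) (δ 0) M.computes P.computes := by
  rintro y z hyz ⟨_, hP, -⟩
  have hinit : ConfRel δ (initConf y) (initConf z) := .initConf hyz
  have hM : M.AllMaximalAccepting (initConf y) := hinit.allMaximalAccepting hMP hP
  refine ⟨?_, fun y₀ ⟨_, c, hc, hy₀⟩ => ?_⟩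
  · obtain ⟨c, hc, y₀, hy₀⟩ := hM.exists_reaches_accepting
    exact ⟨y₀, hM, c, hc, hy₀⟩
  · obtain ⟨d, hd, hrel⟩ := hinit.exists_reaches hMP hP hc
    obtain ⟨z₀, hz₀, hyz₀⟩ := hrel.exists_acceptsWith_right hy₀
    exact ⟨z₀, ⟨hP, d, hd, hz₀⟩, hyz₀⟩

end Machines

end GTM

/-! ## The main theorem -/

theorem Realizes.relComp {n : ℕ} {X : Fin n → Type u} {Y : Fin n → Type v} {Z : Fin n → Type w}
    {X₀ : Type*} {Y₀ : Type*} {Z₀ : Type*} {γ : ∀ j, MultiFun (X j) (Y j)} {γ₀ : MultiFun X₀ Y₀}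
    {δ : ∀ j, MultiFun (Y j) (Z j)} {δ₀ : MultiFun Y₀ Z₀} {h : MultiFun (∀ j, X j) X₀}
    {g : MultiFun (∀ j, Y j) Y₀} {f : MultiFun (∀ j, Z j) Z₀} (hh : Realizes γ γ₀ h g)
    (hg : Realizes δ δ₀ g f) :
    Realizes (fun j => (δ j).relComp (γ j)) (δ₀.relComp γ₀) h f := by
  intro x z hxz hz
  choose y hxy hyz using hxz
  obtain ⟨hgy, hgall⟩ := hg y z hyz hz
  obtain ⟨hhx, hhall⟩ := hh x y hxy hgy
  refine ⟨hhx, fun x₀ hx₀ => ?_⟩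
  obtain ⟨y₀, hy₀, hxy₀⟩ := hhall x₀ hx₀
  obtain ⟨z₀, hz₀, hyz₀⟩ := hgall y₀ hy₀
  exact ⟨z₀, hz₀, y₀, hxy₀, hyz₀⟩

section BoolPart

variable {A : Type} [Alphabet A] {U : Type u}

/-- The restriction of a word-valued multi-function to the arguments where it has exactly one
value and this value is `0` or `1`. It turns an arbitrary realization of a test into a test. -/
def boolPart (g : MultiFun U (List A)) : MultiFun U (List A) :=
  fun x => {w | g x = {w} ∧ w ∈ ({wordZero A, wordOne A} : Set (List A))}

theorem isPartialFun_boolPart (g : MultiFun U (List A)) : (boolPart g).IsPartialFun :=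
  fun _ _ hw _ hw' => Set.singleton_injective (hw.1.symm.trans hw'.1)

theorem boolPart_subset_pair (g : MultiFun U (List A)) (x : U) :
    boolPart g x ⊆ {wordZero A, wordOne A} := fun _ hw => hw.2

theorem boolPart_subset (g : MultiFun U (List A)) (x : U) : boolPart g x ⊆ g x :=
  fun w hw => hw.1 ▸ Set.mem_singleton w

theorem IsComputableWordFun.boolPart {n : ℕ} {g : MultiFun (Fin n → ℕ → A) (List A)}
    (hg : IsComputableWordFun g) : IsComputableWordFun (boolPart g) := by
  obtain ⟨-, M, hM⟩ := hg
  exact ⟨isPartialFun_boolPart g, M, fun p w hw => hM p w (boolPart_subset g p hw)⟩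

variable {n : ℕ} {V : Fin n → Type u} {W : Fin n → Type v}

theorem Realizes.boolPart {ε : ∀ j, MultiFun (V j) (W j)} {g : MultiFun (∀ j, V j) (List A)}
    {f : MultiFun (∀ j, W j) (List A)} (h : Realizes ε (idWord A) g f) (hf : f.IsPartialFun)
    (hf' : ∀ x, f x ⊆ {wordZero A, wordOne A}) : Realizes ε (idWord A) (boolPart g) f := by
  intro x y hxy hne
  have hsub : g x ⊆ f y := h.subset_of_idWord hxy hne
  obtain ⟨⟨w, hw⟩, hall⟩ := h x y hxy hne
  have hgx : g x = {w} := ((hf y).anti hsub).eq_singleton_of_mem hw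
  exact ⟨⟨w, hgx, hf' y (hsub hw)⟩, fun v hv => hall v (boolPart_subset g x hv)⟩

theorem RelComputableWord.boolPart {γ : ∀ j, MultiFun (ℕ → A) (V j)}
    {g : MultiFun (∀ j, V j) (List A)} (hg : RelComputableWord γ g) :
    RelComputableWord γ (boolPart g) := by
  obtain ⟨h, hh, hr⟩ := hg
  refine ⟨h, hh, fun p x hpx ⟨w, hw⟩ => ?_⟩
  obtain ⟨hne, hall⟩ := hr p x hpx ⟨w, boolPart_subset g x hw⟩
  refine ⟨hne, fun v hv => (hall v hv).mono (Set.inter_subset_inter_left _ ?_)⟩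
  rw [hw.1]
  exact Set.singleton_subset_iff.2 hw

end BoolPart

namespace GTM

variable {A : Type} [Alphabet A] {F : GTMFrame} {Y : Fin (F.L + 1) → Type u}
  {Z : Fin (F.L + 1) → Type v} {γ : ∀ i, MultiFun (ℕ → A) (Y i)} {δ : ∀ i, MultiFun (Y i) (Z i)}

theorem _root_.StmtReplaces.exists_isComputable {s : Stmt A F Y} {s' : Stmt A F Z}
    (h : StmtReplaces γ δ s s') :
    ∃ r : Stmt A F fun _ => ℕ → A, Simulates γ r s ∧ r.IsComputable := by
  cases h with
  | right i l => exact ⟨.right i l, simulates_right i l, trivial⟩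
  | left i l => exact ⟨.left i l, simulates_left i l, trivial⟩
  | write i a l => exact ⟨.write i a l, simulates_write i a l, trivial⟩
  | ifSym i a l l' => exact ⟨.ifSym i a l l', simulates_ifSym i a l l', trivial⟩
  | assign i t g f l _ computable =>
    obtain ⟨h, hh, hr⟩ := computable
    exact ⟨.assign i t h l, simulates_assign i hr l, hh⟩
  | test t g hg hg' f hf hf' l l' _ computable =>
    obtain ⟨h, hh, hr⟩ := computable
    exact ⟨.test t (boolPart h) (isPartialFun_boolPart h) (boolPart_subset_pair h) l l',
      simulates_test _ _ hg hg' (hr.boolPart hg hg') l l', hh.boolPart⟩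

theorem ObtainedFrom.relComputable_computes {M : GTM A F Y} {P : GTM A F Z}
    (h : M.ObtainedFrom γ δ P) :
    RelComputable (fun j => γ (F.inTape j)) (γ 0) M.computes := by
  choose r simulates computable using fun l => (h l).exists_isComputable
  exact ⟨computes (X := fun _ => ℕ → A) ⟨r⟩, isComputableSeqFun_computes computable,
    realizes_computes (M := ⟨r⟩) simulates⟩

theorem ObtainedFrom.realizes_computes {M : GTM A F Y} {P : GTM A F Z}
    (h : M.ObtainedFrom γ δ P) :
    Realizes (fun j => δ (F.inTape j)) (δ 0) M.computes P.computes :=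
  GTM.realizes_computes fun l => (h l).simulates

theorem exists_stmtReplaces {s' : Stmt A F Z}
    (hassign : ∀ (i : Fin (F.L + 1)) (n : ℕ) (t : Fin n → Fin (F.L + 1))
      (f : MultiFun (∀ j, Z (t j)) (Z i)) (l' : F.Label), s' = .assign i t f l' →
        ∃ g : MultiFun (∀ j, Y (t j)) (Y i),
          Realizes (fun j => δ (t j)) (δ i) g f ∧ RelComputable (fun j => γ (t j)) (γ i) g)
    (htest : ∀ (n : ℕ) (t : Fin n → Fin (F.L + 1)) (f : MultiFun (∀ j, Z (t j)) (List A))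
      (hf : f.IsPartialFun) (hf' : ∀ x, f x ⊆ {wordZero A, wordOne A}) (l' l'' : F.Label),
      s' = .test t f hf hf' l' l'' →
        ∃ g : MultiFun (∀ j, Y (t j)) (List A),
          Realizes (fun j => δ (t j)) (idWord A) g f ∧
            RelComputableWord (fun j => γ (t j)) g) :
    ∃ s : Stmt A F Y, StmtReplaces γ δ s s' := by
  cases s' with
  | right i l => exact ⟨_, .right i l⟩
  | left i l => exact ⟨_, .left i l⟩
  | write i a l => exact ⟨_, .write i a l⟩
  | ifSym i a l l' => exact ⟨_, .ifSym i a l l'⟩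
  | assign i t f l =>
    obtain ⟨g, hr, hc⟩ := hassign i _ t f l rfl
    exact ⟨_, .assign i t g f l hr hc⟩
  | test t f hf hf' l l' =>
    obtain ⟨g, hr, hc⟩ := htest _ t f hf hf' l l' rfl
    exact ⟨_, .test t (boolPart g) (isPartialFun_boolPart g) (boolPart_subset_pair g) f hf hf' l l'
      (hr.boolPart hf hf') hc.boolPart⟩

end GTM

theorem theoremt5_general {A : Type} [Alphabet A] (F : GTMFrame)
    (Y : Fin (F.L + 1) → Type u) (Z : Fin (F.L + 1) → Type v)
    (P : GTM A F Z) (δ : ∀ i, MultiFun (Y i) (Z i))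
    (γ : ∀ i, MultiFun (ℕ → A) (Y i))
    (hassign : ∀ (l : {l : F.Label // l ≠ F.final}) (i : Fin (F.L + 1)) (n : ℕ)
      (t : Fin n → Fin (F.L + 1)) (f : MultiFun (∀ j, Z (t j)) (Z i)) (l' : F.Label),
      P.stm l = .assign i t f l' →
        ∃ g : MultiFun (∀ j, Y (t j)) (Y i),
          Realizes (fun j => δ (t j)) (δ i) g f ∧ RelComputable (fun j => γ (t j)) (γ i) g)
    (htest : ∀ (l : {l : F.Label // l ≠ F.final}) (n : ℕ)
      (t : Fin n → Fin (F.L + 1)) (f : MultiFun (∀ j, Z (t j)) (List A))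
      (hf : f.IsPartialFun) (hf' : ∀ x, f x ⊆ {wordZero A, wordOne A}) (l' l'' : F.Label),
      P.stm l = .test t f hf hf' l' l'' →
        ∃ g : MultiFun (∀ j, Y (t j)) (List A),
          Realizes (fun j => δ (t j)) (idWord A) g f ∧
            RelComputableWord (fun j => γ (t j)) g) :
    (∃ M : GTM A F Y, M.ObtainedFrom γ δ P) ∧
    (∀ M : GTM A F Y, M.ObtainedFrom γ δ P →
      RelComputable (fun j => γ (F.inTape j)) (γ 0) M.computes ∧
      Realizes (fun j => δ (F.inTape j)) (δ 0) M.computes P.computes) ∧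
    RelComputable (fun j => (δ (F.inTape j)).relComp (γ (F.inTape j)))
      ((δ 0).relComp (γ 0)) P.computes := by
  choose s hs using fun l => GTM.exists_stmtReplaces (hassign l) (htest l)
  have obtained : GTM.ObtainedFrom γ δ ⟨s⟩ P := hs
  obtain ⟨h, hh, hr⟩ := obtained.relComputable_computes
  exact ⟨⟨⟨s⟩, obtained⟩, fun M hM => ⟨hM.relComputable_computes, hM.realizes_computes⟩,
    h, hh, hr.relComp obtained.realizes_computes⟩

theorem theoremt5 {A : Type} [Alphabet A] (F : GTMFrame)
    (Y : Fin (F.L + 1) → Type u) (Z : Fin (F.L + 1) → Type v)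
    (P : GTM A F Z)
    (δ : ∀ i, MultiFun (Y i) (Z i)) (hδ : ∀ i, (δ i).IsMultiRep)
    (γ : ∀ i, MultiFun (ℕ → A) (Y i)) (hγ : ∀ i, (γ i).IsMultiRep)
    (hassign : ∀ (l : {l : F.Label // l ≠ F.final}) (i : Fin (F.L + 1)) (n : ℕ)
      (t : Fin n → Fin (F.L + 1)) (f : MultiFun (∀ j, Z (t j)) (Z i)) (l' : F.Label),
      P.stm l = .assign i t f l' →
        ∃ g : MultiFun (∀ j, Y (t j)) (Y i),
          Realizes (fun j => δ (t j)) (δ i) g f ∧ RelComputable (fun j => γ (t j)) (γ i) g)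
    (htest : ∀ (l : {l : F.Label // l ≠ F.final}) (n : ℕ)
      (t : Fin n → Fin (F.L + 1)) (f : MultiFun (∀ j, Z (t j)) (List A))
      (hf : f.IsPartialFun) (hf' : ∀ x, f x ⊆ {wordZero A, wordOne A}) (l' l'' : F.Label),
      P.stm l = .test t f hf hf' l' l'' →
        ∃ g : MultiFun (∀ j, Y (t j)) (List A),
          Realizes (fun j => δ (t j)) (idWord A) g f ∧
            RelComputableWord (fun j => γ (t j)) g) :
    (∃ M : GTM A F Y, M.ObtainedFrom γ δ P) ∧
    (∀ M : GTM A F Y, M.ObtainedFrom γ δ P →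
      RelComputable (fun j => γ (F.inTape j)) (γ 0) M.computes ∧
      Realizes (fun j => δ (F.inTape j)) (δ 0) M.computes P.computes) ∧
    RelComputable (fun j => (δ (F.inTape j)).relComp (γ (F.inTape j)))
      ((δ 0).relComp (γ 0)) P.computes :=
  theoremt5_general F Y Z P δ γ hassign htest
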